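/- **Definitions.** Let $W$ be a seven-dimensional complex vector space. A *$(G_2)_{\mathbb C}$-structure* on $W$ is a pair $(\varphi,\mathrm{vol})\in\Lambda^3W^*\times\Lambda^7W^*$ for which there is a basis $E_1,\dots,E_7$ of $W$ with dual basis $E^1,\dots,E^7$ such that $\mathrm{vol}=E^{1234567}$ and $$\varphi=E^{127}+E^{347}+E^{567}+E^{135}-E^{146}-E^{236}-E^{245},$$ where $E^{i_1\cdots i_k}=E^{i_1}\wedge\cdots\wedge E^{i_k}$. It induces a non-degenerate symmetric complex bilinear form $g$ on $W$ by $g(v,w)\,\mathrm{vol}=\tfrac16\,(v\lrcorner\varphi)\wedge(w\lrcorner\varphi)\wedge\varphi$; denote the induced bilinear form on $\Lambda^4W^*$ also by $g$. The Hodge dual $\star\varphi$ is the unique four-form with $\varphi\wedge\chi=g(\star\varphi,\chi)\,\mathrm{vol}$ for all $\chi\in\Lambda^4W^*$. A subspace of $W$ is *non-degenerate* if the restriction of $g$ to it is non-degenerate. A $(G_2)_{\mathbb C}$-structure on a seven-dimensional complex Lie algebra $\mathfrak g$ is *cocalibrated* if $d\star\varphi=0$, where $d$ is the exterior derivative on $\Lambda^*\mathfrak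 g^*$ determined by $(d\alpha)(X,Y)=-\alpha([X,Y])$ for one-forms $\alpha$. For a vector space $V$ with a two-form $\omega$, $\mathfrak{sp}(V,\omega)=\{f\in\mathfrak{gl}(V)\mid \omega(f(x),y)+\omega(x,f(y))=0 \text{ for all } x,y\in V\}$. **Theorem.** Let $\mathfrak g$ be a seven-dimensional complex Lie algebra with a codimension-one Abelian ideal $\mathfrak u$. Let $e_7\in\mathfrak g\setminus\mathfrak u$, let $\omega_6\in\Lambda^2\mathfrak u^*$ be non-degenerate, let $V_4$ be a four-dimensional subspace of $\mathfrak u$, $V_2$ a two-dimensional complement of $V_4$ in $\mathfrak u$, and $\omega_4\in\Lambda^2V_4^*$ non-degenerate. Then: (a) $\mathfrak g$ admits a cocalibrated $(G_2)_{\mathbb C}$-structure such that $\mathfrak u$ is a non-degenerate subspace of $\mathfrak g$ with respect to the induced symmetric complex bilinear form if and only if $\mathrm{ad}(e_7)|_{\mathfrak u}\in\mathfrak{gl}(\mathfrak u)$ is similar under $\mathrm{GL}(\mathfrak u)$ to an element of $\mathfrak{sp}(\mathfrak u,\omega_6)$. (b) $\mathfrak g$ admits a cocalibrated $(G_2)_{\mathbb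 C}$-structure if and only if $\mathrm{ad}(e_7)|_{\mathfrak u}$ is similar under $\mathrm{GL}(\mathfrak u)$ to an element of $\mathfrak{sp}(\mathfrak u,\omega_6)$ or to an element of $$\Bigl\{f\in\mathfrak{gl}(\mathfrak u)\Bigm| f|_{V_2}=f_2+h,\ f_2\in\mathfrak{gl}(V_2),\ h\in\mathrm{Hom}(V_2,V_4),\ f|_{V_4}=-\tfrac{\mathrm{tr}(f_2)}{2}\,\mathrm{id}_{V_4}+f_4,\ f_4\in\mathfrak{sp}(V_4,\omega_4)\Bigr\}.$$ -/

import Mathlib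

open Module

noncomputable section

namespace G2C

section Forms

variable {W : Type*} [AddCommGroup W] [Module ℂ W]

/-- The space of complex `k`-forms on `W`. -/
abbrev Form (W : Type*) [AddCommGroup W] [Module ℂ W] (k : ℕ) : Type _ :=
  W [⋀^Fin k]→ₗ[ℂ] ℂ

/-- The form `α₁ ∧ … ∧ αₘ`, that is `(v₁, …, vₘ) ↦ det (αᵢ (vⱼ))`. -/
def covectorWedge {m : ℕ} (α : Fin m → Dual ℂ W) : Form W m :=
  (Matrix.detRowAlternating (R := ℂ) (n := Fin m)).compLinearMap (LinearMap.pi α)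

/-- For a basis `E` and a multi-index `I = (i₁, …, iₘ)`, the form `E^{i₁} ∧ … ∧ E^{iₘ}` in the dual
basis (indices are counted from `0`). -/
def basisForm {n m : ℕ} (E : Basis (Fin n) ℂ W) (I : Fin m → Fin n) : Form W m :=
  covectorWedge fun k => E.coord (I k)

/-- The wedge product of forms: the signed sum over all `(k, l)`-shuffles. -/
def wedge {k l : ℕ} (a : Form W k) (b : Form W l) : Form W (k + l) :=
  ((LinearMap.mul' ℂ ℂ).compAlternatingMap (a.domCoprod b)).domDomCongr finSumFinEquiv

/-- The interior product `v ⌟ a`, that is `(v₁, …, vₖ) ↦ a (v, v₁, …, vₖ)`. -/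
def interior {k : ℕ} (v : W) (a : Form W (k + 1)) : Form W k :=
  a.curryLeft v

/-- The bilinear form that a non-degenerate bilinear form `B` on `W` induces on `m`-forms,
`(1 / m!) ∑ a(b_{i₁}, …, b_{iₘ}) c(b^{i₁}, …, b^{iₘ})` for a basis `(bᵢ)` of `W` and its `B`-dual
basis `(bⁱ)` of `W`. By `formInner_flat` it is the usual one, determined by
`⟨v₁♭ ∧ … ∧ vₘ♭, w₁♭ ∧ … ∧ wₘ♭⟩ = det (B (vᵢ, wⱼ))`; in particular the basis does not matter. -/
def formInner [FiniteDimensional ℂ W] (B : LinearMap.BilinForm ℂ W) (hB : B.Nondegenerate)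
    {m : ℕ} (a c : Form W m) : ℂ :=
  ((m.factorial : ℂ))⁻¹ * ∑ I : Fin m → Fin (finrank ℂ W),
    a (fun k => finBasis ℂ W (I k)) * c (fun k => B.dualBasis hB (finBasis ℂ W) (I k))

theorem formInner_flat_left [FiniteDimensional ℂ W] (B : LinearMap.BilinForm ℂ W)
    (hB : B.Nondegenerate) {m : ℕ} (v : Fin m → W) (c : Form W m) :
    formInner B hB (covectorWedge fun k => B (v k)) c = c v := by
  set b := finBasis ℂ W
  set d := B.dualBasis hB b
  have hx : ∀ x : W, x = ∑ i, B x (b i) • d i := fun x => by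
    conv_lhs => rw [← d.sum_repr x]
    simp [d, LinearMap.BilinForm.dualBasis_repr_apply]
  have key : ∀ u : Fin m → W,
      c u = ∑ I : Fin m → Fin (finrank ℂ W), (∏ k, B (u k) (b (I k))) * c (fun k => d (I k)) := by
    intro u
    have h1 : c u = c.toMultilinearMap fun k => ∑ i, B (u k) (b i) • d i :=
      congrArg c (funext fun k => hx (u k))
    rw [h1, MultilinearMap.map_sum]
    refine Finset.sum_congr rfl fun I _ => ?_
    rw [MultilinearMap.map_smul_univ]
    rfl
  have hdet : ∀ I : Fin m → Fin (finrank ℂ W),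
      covectorWedge (fun k => B (v k)) (fun k => b (I k)) =
        ∑ σ : Equiv.Perm (Fin m), (Equiv.Perm.sign σ : ℂ) * ∏ k, B (v (σ k)) (b (I k)) := by
    intro I
    have h2 : covectorWedge (fun k => B (v k)) (fun k => b (I k)) =
        (Matrix.of fun j i => B (v i) (b (I j))).det := rfl
    rw [h2, ← Matrix.det_transpose, Matrix.det_apply']
    rfl
  have hperm : ∀ σ : Equiv.Perm (Fin m),
      (Equiv.Perm.sign σ : ℂ) * c (fun k => v (σ k)) = c v := by
    intro σ
    have h3 : c (fun k => v (σ k)) = Equiv.Perm.sign σ • c v := c.map_perm v σ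
    rw [h3, Units.smul_def, zsmul_eq_mul, ← mul_assoc, ← Int.cast_mul, ← Units.val_mul,
      Int.units_mul_self]
    simp
  unfold formInner
  simp_rw [show ∀ I : Fin m → Fin (finrank ℂ W),
      covectorWedge (fun k => B (v k)) (fun k => finBasis ℂ W (I k)) = _ from hdet,
    Finset.sum_mul]
  rw [Finset.sum_comm]
  simp_rw [mul_assoc, ← Finset.mul_sum]
  rw [Finset.sum_congr rfl fun σ _ => by
    rw [show (∑ I : Fin m → Fin (finrank ℂ W), (∏ k, B (v (σ k)) (b (I k))) *
      c (fun k => B.dualBasis hB (finBasis ℂ W) (I k))) = c (fun k => v (σ k)) from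
        (key fun k => v (σ k)).symm, hperm σ]]
  rw [Finset.sum_const, Finset.card_univ, Fintype.card_perm, Fintype.card_fin, nsmul_eq_mul,
    inv_mul_cancel_left₀ (Nat.cast_ne_zero.mpr m.factorial_ne_zero)]

theorem formInner_flat [FiniteDimensional ℂ W] (B : LinearMap.BilinForm ℂ W)
    (hB : B.Nondegenerate) {m : ℕ} (v w : Fin m → W) :
    formInner B hB (covectorWedge fun k => B (v k)) (covectorWedge fun k => B (w k)) =
      (Matrix.of fun i j => B (w j) (v i)).det := by
  rw [formInner_flat_left]
  rfl

/-- `(φ, vol)` is a `(G₂)_ℂ`-structure on the complex vector space `W`: for some basis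
`E₁, …, E₇` of `W`, `vol = E^{1234567}` and
`φ = E^{127} + E^{347} + E^{567} + E^{135} - E^{146} - E^{236} - E^{245}`. -/
def IsG2Structure (φ : Form W 3) (vol : Form W 7) : Prop :=
  ∃ E : Basis (Fin 7) ℂ W,
    vol = basisForm E ![0, 1, 2, 3, 4, 5, 6] ∧
    φ = basisForm E ![0, 1, 6] + basisForm E ![2, 3, 6] + basisForm E ![4, 5, 6]
      + basisForm E ![0, 2, 4] - basisForm E ![0, 3, 5] - basisForm E ![1, 2, 5]
      - basisForm E ![1, 3, 4]

/-- `B` is the symmetric bilinear form induced by `(φ, vol)`: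
`B(v, w) vol = (1/6) (v ⌟ φ) ∧ (w ⌟ φ) ∧ φ`. -/
def IsInducedForm (φ : Form W 3) (vol : Form W 7) (B : LinearMap.BilinForm ℂ W) : Prop :=
  ∀ v w : W, B v w • vol = (1 / 6 : ℂ) • wedge (wedge (interior v φ) (interior w φ)) φ

theorem IsInducedForm.unique {φ : Form W 3} {vol : Form W 7} (hvol : vol ≠ 0)
    {B B' : LinearMap.BilinForm ℂ W} (h : IsInducedForm φ vol B) (h' : IsInducedForm φ vol B') :
    B = B' := by
  ext v w
  exact smul_left_injective ℂ hvol ((h v w).trans (h' v w).symm)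

/-- `Ψ` is the Hodge dual of `φ` for the Hodge star operator of the `(G₂)_ℂ`-structure
`(φ, vol)`: `φ ∧ χ = ⟨Ψ, χ⟩ vol` for all `4`-forms `χ`, where `⟨·,·⟩` is induced by the bilinear
form of `(φ, vol)`. -/
def IsHodgeDual [FiniteDimensional ℂ W] (φ : Form W 3) (vol : Form W 7) (Ψ : Form W 4) : Prop :=
  ∃ (B : LinearMap.BilinForm ℂ W) (hB : B.Nondegenerate), IsInducedForm φ vol B ∧
    ∀ χ : Form W 4, wedge φ χ = formInner B hB Ψ χ • vol

/-- The subspace `U` is non-degenerate for the bilinear form induced by `(φ, vol)`. -/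
def IsNondegenerateSubspace (φ : Form W 3) (vol : Form W 7) (U : Submodule ℂ W) : Prop :=
  ∃ B : LinearMap.BilinForm ℂ W, IsInducedForm φ vol B ∧ (B.restrict U).Nondegenerate

end Forms

section LieAlgebra

variable {𝔤 : Type*} [LieRing 𝔤] [LieAlgebra ℂ 𝔤]

/-- The exterior derivative of a form on a Lie algebra (as a left-invariant form):
`dω(X₀, …, Xₖ) = ∑_{i < j} (-1)^{i + j} ω([Xᵢ, Xⱼ], X₀, …, X̂ᵢ, …, X̂ⱼ, …, Xₖ)`. -/
def lieExtDeriv {k : ℕ} (ω : Form 𝔤 (k + 1)) (X : Fin (k + 2) → 𝔤) : ℂ :=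
  ∑ i : Fin (k + 1), ∑ j : Fin (k + 2), if i.castSucc < j then
    (-1) ^ ((i : ℕ) + (j : ℕ)) *
      ω (Fin.cons ⁅X i.castSucc, X j⁆ (i.removeNth (j.removeNth X)))
  else 0

/-- On one-forms, `dα(X, Y) = -α([X, Y])`. -/
theorem lieExtDeriv_one (α : Form 𝔤 1) (X Y : 𝔤) : lieExtDeriv α ![X, Y] = -α ![⁅X, Y⁆] := by
  have h : (Fin.cons ⁅X, Y⁆ ((0 : Fin 1).removeNth ((1 : Fin 2).removeNth ![X, Y])) : Fin 1 → 𝔤) =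
      ![⁅X, Y⁆] := by
    funext i
    fin_cases i
    rfl
  simp [lieExtDeriv, Fin.sum_univ_two, h, -Fin.removeNth_zero]

/-- `(φ, vol)` is a cocalibrated `(G₂)_ℂ`-structure on the Lie algebra: `d ⋆φ = 0`. -/
def IsCocalibratedG2Structure [FiniteDimensional ℂ 𝔤] (φ : Form 𝔤 3) (vol : Form 𝔤 7) : Prop :=
  IsG2Structure φ vol ∧ ∃ Ψ : Form 𝔤 4, IsHodgeDual φ vol Ψ ∧ lieExtDeriv Ψ = 0

end LieAlgebra

section Endomorphisms

variable {U : Type*} [AddCommGroup U] [Module ℂ U]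

/-- `f` is similar under `GL(U)` to an element of `S`. -/
def IsSimilarToElementOf (f : End ℂ U) (S : Set (End ℂ U)) : Prop :=
  ∃ T : U ≃ₗ[ℂ] U, T.conj f ∈ S

/-- For `U = V₂ ⊕ V₄` and a two-form `ω` on `V₄`, the set of all `f` with `f|_{V₂} = f₂ + h` and
`f|_{V₄} = -(tr f₂ / 2) id + f₄`, where `f₂ ∈ gl(V₂)`, `h ∈ Hom(V₂, V₄)`, `f₄ ∈ sp(V₄, ω)`. -/
def lengthTwoStabilizer (V₂ V₄ : Submodule ℂ U) (ω : LinearMap.BilinForm ℂ V₄) :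
    Set (End ℂ U) :=
  {f | ∃ (f₂ : End ℂ V₂) (h : V₂ →ₗ[ℂ] V₄) (f₄ : End ℂ V₄),
    f₄ ∈ skewAdjointLieSubalgebra ω ∧
    (∀ v : V₂, f v = f₂ v + h v) ∧
    (∀ v : V₄, f v = (-(LinearMap.trace ℂ V₂ f₂ / 2)) • (v : U) + f₄ v)}

end Endomorphisms

end G2C

end

/-!
Let `F = ad e₇` and let `α` be the covector with kernel `𝔲` and `α e₇ = 1`. As `𝔲` is Abelian,
`[x, y] = α(x) F y - α(y) F x`, hence `dΨ = -α ∧ D_F Ψ`, where `D_F` is the derivation of the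
algebra of forms extending the transpose of `F`.

Let `n` be the vector dual to `α`. Since `α ∧ β ∧ γ ∧ ⋆φ = φ(n, β♯, γ♯) vol` and `D_F` multiplies
`7`-forms by `tr F`, the Leibniz rule turns `α ∧ D_F ⋆φ = 0` into the statement that `n ⌟ φ` is
conformal, with factor `tr F`, under the `g`-adjoint of `F`. The form `n ⌟ φ` is obtained by pulling
back a symplectic form along the cross product `x ↦ n × x` onto its image, so this says that the
image `n × 𝔤 ⊆ 𝔲` is `F`-invariant and that `F` scales its symplectic form by `tr F`. The image is
all of `𝔲` if `g(n, n) ≠ 0`, that is, if `𝔲` is non-degenerate, and is four-dimensional if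
`g(n, n) = 0`.

Conversely, every `F`-invariant symplectic subspace of `𝔲` of dimension six or four on which `F`
acts conformally with factor `tr F` is such an image for some basis, because symplectic spaces of
equal dimension are isomorphic.

Finally, a conformal endomorphism of factor `c` on a symplectic space of dimension `2m` has trace
`m c`; in dimension six this and `c = tr F` force `c = 0`, and in dimension four they give
`c = -tr F₂`, where `F₂` is the map induced by `F` on `𝔲 / (n × 𝔤)`.
-/

noncomputable section

namespace G2C

open scoped Matrix

section Forms

variable {W : Type*} [AddCommGroup W] [Module ℂ W] {k l m n : ℕ}

theorem form_sum_apply {ι : Type*} (s : Finset ι) (a : ι → Form W m) (v : Fin m → W) :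
    (∑ i ∈ s, a i) v = ∑ i ∈ s, a i v := by
  change AlternatingMap.toMultilinearMapLM (S := ℂ) (∑ i ∈ s, a i) v = _
  rw [map_sum, sum_apply]
  rfl

theorem covectorWedge_apply (α : Fin m → Dual ℂ W) (v : Fin m → W) :
    covectorWedge α v = (Matrix.of fun i j => α i (v j)).det := by
  rw [← Matrix.det_transpose]
  rfl

theorem covectorWedge_eq_alternatization (α : Fin m → Dual ℂ W) :
    covectorWedge α = MultilinearMap.alternatization
      ((MultilinearMap.mkPiAlgebra ℂ (Fin m) ℂ).compLinearMap α) := by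
  ext v
  rw [covectorWedge_apply, MultilinearMap.alternatization_apply, ← Matrix.det_transpose,
    Matrix.det_apply]
  exact Finset.sum_congr rfl fun σ _ => by simp

theorem covectorWedge_wedge (α : Fin k → Dual ℂ W) (β : Fin l → Dual ℂ W) :
    wedge (covectorWedge α) (covectorWedge β) = covectorWedge (Fin.append α β) := by
  unfold wedge
  simp only [covectorWedge_eq_alternatization]
  rw [← MultilinearMap.domCoprod_alternization]
  ext v
  simp only [AlternatingMap.domDomCongr_apply, LinearMap.compAlternatingMap_apply,
    MultilinearMap.alternatization_apply, map_sum, map_zsmul_unit]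
  rw [← Equiv.sum_comp finSumFinEquiv.permCongr]
  refine Finset.sum_congr rfl fun σ _ => ?_
  rw [Equiv.Perm.sign_permCongr]
  congr 1
  simp [← finSumFinEquiv.prod_comp, Equiv.permCongr_apply]

@[simp]
theorem wedge_add_left (a a' : Form W k) (b : Form W l) :
    wedge (a + a') b = wedge a b + wedge a' b := by
  simp only [wedge, ← AlternatingMap.domCoprod'_apply, TensorProduct.add_tmul, map_add]
  ext; simp

@[simp]
theorem wedge_smul_left (c : ℂ) (a : Form W k) (b : Form W l) :
    wedge (c • a) b = c • wedge a b := by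
  simp only [wedge, ← AlternatingMap.domCoprod'_apply, ← TensorProduct.smul_tmul', map_smul]
  ext; simp

@[simp]
theorem wedge_add_right (a : Form W k) (b b' : Form W l) :
    wedge a (b + b') = wedge a b + wedge a b' := by
  simp only [wedge, ← AlternatingMap.domCoprod'_apply, TensorProduct.tmul_add, map_add]
  ext; simp

@[simp]
theorem wedge_smul_right (c : ℂ) (a : Form W k) (b : Form W l) :
    wedge a (c • b) = c • wedge a b := by
  simp only [wedge, ← AlternatingMap.domCoprod'_apply, TensorProduct.tmul_smul, map_smul]
  ext; simp

/-- The wedge product as a bilinear map. -/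
def wedgeₗ (k l : ℕ) : Form W k →ₗ[ℂ] Form W l →ₗ[ℂ] Form W (k + l) :=
  LinearMap.mk₂ ℂ wedge wedge_add_left wedge_smul_left wedge_add_right wedge_smul_right

theorem wedge_sum_left {ι : Type*} (s : Finset ι) (a : ι → Form W k) (b : Form W l) :
    wedge (∑ i ∈ s, a i) b = ∑ i ∈ s, wedge (a i) b :=
  map_sum ((wedgeₗ k l).flip b) a s

theorem wedge_sum_right {ι : Type*} (s : Finset ι) (a : Form W k) (b : ι → Form W l) :
    wedge a (∑ i ∈ s, b i) = ∑ i ∈ s, wedge a (b i) :=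
  map_sum (wedgeₗ k l a) b s

/-- The bilinear form for which the basis `E` is orthonormal. -/
def orthoForm (E : Basis (Fin n) ℂ W) : LinearMap.BilinForm ℂ W :=
  (dotProductBilin ℂ ℂ (m := Fin n)).compl₁₂ E.equivFun.toLinearMap E.equivFun.toLinearMap

theorem orthoForm_apply (E : Basis (Fin n) ℂ W) (v w : W) :
    orthoForm E v w = ∑ i, E.coord i v * E.coord i w := by
  simp [orthoForm, dotProduct, dotProductBilin]

theorem orthoForm_basis_left (E : Basis (Fin n) ℂ W) (i : Fin n) :
    orthoForm E (E i) = E.coord i := by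
  ext w
  simp [orthoForm_apply, Finsupp.single_apply]

theorem orthoForm_comm (E : Basis (Fin n) ℂ W) (v w : W) :
    orthoForm E v w = orthoForm E w v := by
  simp only [orthoForm_apply, mul_comm]

theorem orthoForm_nondegenerate (E : Basis (Fin n) ℂ W) : (orthoForm E).Nondegenerate := by
  have left : ∀ v, (∀ w, orthoForm E v w = 0) → v = 0 := fun v hv =>
    E.ext_elem fun i => by
      simpa [orthoForm_basis_left] using (orthoForm_comm E (E i) v).trans (hv (E i))
  exact ⟨left, fun v hv => left v fun w => (orthoForm_comm E v w).trans (hv w)⟩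

theorem form_eq_sum_covectorWedge [FiniteDimensional ℂ W] {B : LinearMap.BilinForm ℂ W}
    (hB : B.Nondegenerate) (hs : ∀ v w, B v w = B w v) (c : Form W m) :
    c = ((m.factorial : ℂ))⁻¹ • ∑ I : Fin m → Fin (finrank ℂ W),
      c (fun k => B.dualBasis hB (finBasis ℂ W) (I k)) •
        covectorWedge (fun k => B (finBasis ℂ W (I k))) := by
  ext v
  rw [← formInner_flat_left B hB v c, formInner]
  simp only [AlternatingMap.smul_apply, form_sum_apply, smul_eq_mul]
  congr 1
  refine Finset.sum_congr rfl fun I _ => ?_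
  rw [mul_comm, covectorWedge_apply, covectorWedge_apply, ← Matrix.det_transpose]
  congr 2
  ext i j
  exact hs _ _

@[elab_as_elim]
theorem form_induction [FiniteDimensional ℂ W] {p : Form W m → Prop}
    (covectorWedge : ∀ α : Fin m → Dual ℂ W, p (covectorWedge α))
    (add : ∀ a b, p a → p b → p (a + b)) (smul : ∀ (c : ℂ) a, p a → p (c • a))
    (a : Form W m) : p a := by
  have zero : p 0 := by simpa using smul 0 _ (covectorWedge 0)
  have sum {ι : Type} (s : Finset ι) (f : ι → Form W m) (hf : ∀ i, p (f i)) :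
      p (∑ i ∈ s, f i) :=
    Finset.sum_induction f p add zero fun i _ => hf i
  rw [form_eq_sum_covectorWedge (orthoForm_nondegenerate (finBasis ℂ W)) (orthoForm_comm _) a]
  exact smul _ _ (sum _ _ fun I => smul _ _ (covectorWedge _))

theorem covectorWedge_append_apply_append (α : Fin k → Dual ℂ W) (β : Fin l → Dual ℂ W)
    (v : Fin k → W) (w : Fin l → W) :
    covectorWedge (Fin.append α β) (Fin.append v w) =
      (Matrix.fromBlocks (Matrix.of fun i j => α i (v j)) (Matrix.of fun i j => α i (w j))
        (Matrix.of fun i j => β i (v j)) (Matrix.of fun i j => β i (w j))).det := by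
  rw [covectorWedge_apply, ← Matrix.det_submatrix_equiv_self finSumFinEquiv]
  congr 1
  ext (i | i) (j | j) <;> simp

theorem covectorWedge_wedge_apply_append [FiniteDimensional ℂ W] {α : Fin k → Dual ℂ W}
    (v : Fin k → W) {w : Fin l → W} (h : ∀ i j, α i (w j) = 0) (χ : Form W l) :
    wedge (covectorWedge α) χ (Fin.append v w) = covectorWedge α v * χ w := by
  induction χ using form_induction with
  | covectorWedge β =>
    have hαw : (Matrix.of fun i j => α i (w j)) = 0 := by ext i j; exact h i j
    rw [covectorWedge_wedge, covectorWedge_append_apply_append, hαw,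
      Matrix.det_fromBlocks_zero₁₂, ← covectorWedge_apply, ← covectorWedge_apply]
  | add a b ha hb => simp [ha, hb, mul_add]
  | smul c a ha => simp [ha, mul_left_comm]

theorem wedge_covectorWedge_apply_append [FiniteDimensional ℂ W] {α : Fin k → Dual ℂ W}
    (v : Fin k → W) {w : Fin l → W} (h : ∀ i j, α i (w j) = 0) (χ : Form W l) :
    wedge χ (covectorWedge α) (Fin.append w v) = χ w * covectorWedge α v := by
  induction χ using form_induction with
  | covectorWedge β =>
    have hαw : (Matrix.of fun i j => α i (w j)) = 0 := by ext i j; exact h i j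
    rw [covectorWedge_wedge, covectorWedge_append_apply_append, hαw,
      Matrix.det_fromBlocks_zero₂₁, ← covectorWedge_apply, ← covectorWedge_apply]
  | add a b ha hb => simp [ha, hb, add_mul]
  | smul c a ha => simp [ha, mul_assoc]

theorem wedge_two_two_apply [FiniteDimensional ℂ W] (a b : Form W 2) (x y z w : W) :
    wedge a b ![x, y, z, w] = a ![x, y] * b ![z, w] - a ![x, z] * b ![y, w]
      + a ![x, w] * b ![y, z] + a ![y, z] * b ![x, w] - a ![y, w] * b ![x, z]
      + a ![z, w] * b ![x, y] := by
  induction a using form_induction with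
  | add a a' ha ha' =>
    simp only [wedge_add_left, AlternatingMap.add_apply, ha, ha']
    ring
  | smul c a ha =>
    simp only [wedge_smul_left, AlternatingMap.smul_apply, ha, smul_eq_mul]
    ring
  | covectorWedge α =>
    induction b using form_induction with
    | add b b' hb hb' =>
      simp only [wedge_add_right, AlternatingMap.add_apply, hb, hb']
      ring
    | smul c b hb =>
      simp only [wedge_smul_right, AlternatingMap.smul_apply, hb, smul_eq_mul]
      ring
    | covectorWedge β =>
      have append_eq : (Fin.append α β : Fin 4 → Dual ℂ W) = ![α 0, α 1, β 0, β 1] := by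
        ext i; fin_cases i <;> rfl
      rw [covectorWedge_wedge, append_eq]
      refine (covectorWedge_apply (m := 4) _ _).trans ?_
      simp only [covectorWedge_apply, Matrix.det_fin_two, Matrix.det_succ_row_zero (n := 3),
        Matrix.det_fin_three, Fin.sum_univ_four, Matrix.of_apply, Matrix.submatrix_apply,
        Matrix.cons_val, Fin.succAbove, Fin.succ, Fin.lt_def, Fin.castSucc]
      simp only [Fin.coe_ofNat_eq_mod, Fin.reduceCastAdd, Fin.reduceFinMk, Nat.reduceAdd,
        Nat.reduceMod, Matrix.cons_val, Nat.lt_irrefl, Nat.reduceLT, if_true, if_false]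
      ring

end Forms

section FormDeriv

variable {W : Type*} [AddCommGroup W] [Module ℂ W] {k l : ℕ}

theorem sum_compLinearMap_update_apply (F : End ℂ W) (a : Form W k) (v : Fin k → W) :
    (∑ i, a.toMultilinearMap.compLinearMap (Function.update (fun _ => LinearMap.id) i F)) v =
      ∑ i, a (Function.update v i (F (v i))) := by
  rw [sum_apply]
  refine Finset.sum_congr rfl fun i _ => congrArg a (funext fun j => ?_)
  obtain rfl | hj := eq_or_ne j i <;> simp [*]

theorem map_update_add_map_update_eq_zero (a : Form W k) {v : Fin k → W} {i j : Fin k}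
    (hv : v i = v j) (hij : i ≠ j) (x : W) :
    a (Function.update v i x) + a (Function.update v j x) = 0 := by
  have swap : Function.update v j x = Function.update v i x ∘ Equiv.swap i j := by
    rw [Equiv.comp_swap_eq_update, Function.update_self, Function.update_of_ne hij.symm, ← hv,
      Function.update_comm hij, Function.update_idem]
    exact (Function.update_eq_self_iff.2 (Function.update_of_ne hij _ _).symm).symm
  rw [swap, add_comm]
  exact a.map_swap_add _ hij

/-- The action of an endomorphism `F` on forms as a derivation,
`(v₁, …, vₖ) ↦ ∑ᵢ a (v₁, …, F vᵢ, …, vₖ)`. On covectors it is the transpose of `F`, so it is minus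
the natural action of `𝔤𝔩(W)`. -/
def formDeriv (F : End ℂ W) (a : Form W k) : Form W k where
  __ := ∑ i, a.toMultilinearMap.compLinearMap (Function.update (fun _ => LinearMap.id) i F)
  map_eq_zero_of_eq' v i j hv hij := by
    refine (sum_compLinearMap_update_apply F a v).trans ?_
    rw [Finset.sum_eq_add i j hij (fun l _ hl => ?_) (by simp) (by simp), hv]
    · exact map_update_add_map_update_eq_zero a hv hij _
    · exact a.map_eq_zero_of_eq _
        (by rw [Function.update_of_ne hl.1.symm, Function.update_of_ne hl.2.symm, hv]) hij

theorem formDeriv_apply (F : End ℂ W) (a : Form W k) (v : Fin k → W) :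
    formDeriv F a v = ∑ i, a (Function.update v i (F (v i))) :=
  sum_compLinearMap_update_apply F a v

@[simp]
theorem formDeriv_add (F : End ℂ W) (a b : Form W k) :
    formDeriv F (a + b) = formDeriv F a + formDeriv F b := by
  ext v
  simp [formDeriv_apply, Finset.sum_add_distrib]

@[simp]
theorem formDeriv_smul (F : End ℂ W) (c : ℂ) (a : Form W k) :
    formDeriv F (c • a) = c • formDeriv F a := by
  ext v
  simp [formDeriv_apply, Finset.mul_sum]

theorem formDeriv_covectorWedge (F : End ℂ W) (α : Fin k → Dual ℂ W) :
    formDeriv F (covectorWedge α) =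
      ∑ i, covectorWedge (Function.update α i (α i ∘ₗ F)) := by
  ext v
  simp only [formDeriv_apply, form_sum_apply, covectorWedge_apply, Matrix.det_apply']
  rw [Finset.sum_comm, Finset.sum_comm (s := Finset.univ (α := Fin k))]
  refine Finset.sum_congr rfl fun σ _ => ?_
  refine Eq.trans ?_ (Equiv.sum_comp σ _)
  refine Finset.sum_congr rfl fun i _ => congrArg _ (Finset.prod_congr rfl fun j _ => ?_)
  obtain rfl | hj := eq_or_ne j i <;> simp [*]

theorem update_append_castAdd {X : Type*} (v : Fin k → X) (w : Fin l → X) (i : Fin k) (x : X) :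
    Function.update (Fin.append v w) (Fin.castAdd l i) x =
      Fin.append (Function.update v i x) w := by
  ext j
  refine j.addCases (fun j => ?_) fun j => ?_
  · simp [Function.update_apply]
  · have : Fin.natAdd k j ≠ Fin.castAdd l i := by
      grind [Fin.ext_iff, Fin.val_castAdd, Fin.val_natAdd]
    simp [this]

theorem update_append_natAdd {X : Type*} (v : Fin k → X) (w : Fin l → X) (i : Fin l) (x : X) :
    Function.update (Fin.append v w) (Fin.natAdd k i) x =
      Fin.append v (Function.update w i x) := by
  ext j
  refine j.addCases (fun j => ?_) fun j => ?_
  · have : Fin.castAdd l j ≠ Fin.natAdd k i := by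
      grind [Fin.ext_iff, Fin.val_castAdd, Fin.val_natAdd]
    simp [this]
  · simp [Function.update_apply]

theorem formDeriv_wedge [FiniteDimensional ℂ W] (F : End ℂ W) (a : Form W k) (b : Form W l) :
    formDeriv F (wedge a b) = wedge (formDeriv F a) b + wedge a (formDeriv F b) := by
  induction a using form_induction with
  | add a a' ha ha' => simp [ha, ha']; abel
  | smul c a ha => simp [ha]
  | covectorWedge α =>
    induction b using form_induction with
    | add b b' hb hb' => simp [hb, hb']; abel
    | smul c b hb => simp [hb]
    | covectorWedge β =>
      simp only [covectorWedge_wedge, formDeriv_covectorWedge, Fin.sum_univ_add, wedge_sum_left,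
        wedge_sum_right, Fin.append_left, Fin.append_right, update_append_castAdd,
        update_append_natAdd]

theorem formDeriv_eq_trace_smul (b : Basis (Fin k) ℂ W) (F : End ℂ W) (a : Form W k) :
    formDeriv F a = LinearMap.trace ℂ W F • a := by
  have diagonal (i : Fin k) :
      a (Function.update b i (F (b i))) = b.coord i (F (b i)) * a b := by
    conv_lhs => rw [← b.sum_repr (F (b i)), a.map_update_sum]
    rw [Finset.sum_eq_single i (fun j _ hj => ?_) (by simp)]
    · simp
    · rw [a.map_update_smul, a.map_update_self _ hj.symm, smul_zero]
  have at_basis : formDeriv F a b = LinearMap.trace ℂ W F * a b := by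
    rw [formDeriv_apply, LinearMap.trace_eq_matrix_trace ℂ b, Matrix.trace, Finset.sum_mul]
    exact Finset.sum_congr rfl fun i _ => by
      rw [diagonal, Matrix.diag_apply, LinearMap.toMatrix_apply, Basis.coord_apply]
  rw [(formDeriv F a).eq_smul_basis_det b, at_basis, mul_smul, ← a.eq_smul_basis_det b]

end FormDeriv

section CovectorMul

variable {W : Type*} [AddCommGroup W] [Module ℂ W] {k m n : ℕ}

/-- The form `α ∧ χ` for a covector `α`, in degree `k + 1` rather than in the degree `1 + k` that
`wedge` produces. -/
def covectorMul (α : Dual ℂ W) (χ : Form W k) : Form W (k + 1) :=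
  AlternatingMap.alternatizeUncurryFin (α.smulRight χ)

theorem covectorMul_covectorWedge (α : Dual ℂ W) (δ : Fin k → Dual ℂ W) :
    covectorMul α (covectorWedge δ) = covectorWedge (Fin.cons α δ) := by
  ext v
  rw [covectorMul, AlternatingMap.alternatizeUncurryFin_apply, covectorWedge_apply,
    Matrix.det_succ_row_zero]
  refine Finset.sum_congr rfl fun i _ => ?_
  simp only [LinearMap.smulRight_apply, AlternatingMap.smul_apply, covectorWedge_apply,
    zsmul_eq_mul, smul_eq_mul, Matrix.of_apply, Fin.cons_zero, Int.cast_pow, Int.cast_neg,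
    Int.cast_one, mul_assoc]
  rfl

theorem covectorWedge_comp_cast (h : m = n) (γ : Fin n → Dual ℂ W) (v : Fin n → W) :
    covectorWedge (γ ∘ Fin.cast h) (v ∘ Fin.cast h) = covectorWedge γ v := by
  subst h
  rfl

theorem covectorMul_apply_eq_wedge [FiniteDimensional ℂ W] (α : Dual ℂ W) (χ : Form W k)
    (v : Fin (k + 1) → W) :
    covectorMul α χ v = wedge (covectorWedge ![α]) χ (v ∘ Fin.cast (Nat.add_comm 1 k)) := by
  induction χ using form_induction with
  | covectorWedge δ =>
    rw [covectorWedge_wedge, Fin.append_left_eq_cons, covectorWedge_comp_cast,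
      covectorMul_covectorWedge]
    rfl
  | add a b ha hb =>
    rw [wedge_add_right, AlternatingMap.add_apply, ← ha, ← hb, covectorMul]
    simp [AlternatingMap.alternatizeUncurryFin_apply, covectorMul, Finset.sum_add_distrib]
  | smul c a ha =>
    rw [wedge_smul_right, AlternatingMap.smul_apply, ← ha, covectorMul]
    simp [AlternatingMap.alternatizeUncurryFin_apply, covectorMul, Finset.mul_sum, mul_left_comm]

theorem wedge_covectorWedge_compLinearMap [FiniteDimensional ℂ W] (δ : Fin m → Dual ℂ W)
    (i : Fin m) (e : W) (χ : Form W k) :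
    wedge (covectorWedge δ) (χ.compLinearMap (LinearMap.id - (δ i).smulRight e)) =
      wedge (covectorWedge δ) χ := by
  induction χ using form_induction with
  | covectorWedge β =>
    have comp : (covectorWedge β).compLinearMap (LinearMap.id - (δ i).smulRight e) =
        covectorWedge fun j => β j - β j e • δ i := by
      ext v
      simp [covectorWedge_apply, mul_comm]
    rw [comp, covectorWedge_wedge, covectorWedge_wedge]
    ext v
    rw [covectorWedge_apply, covectorWedge_apply]
    refine Matrix.det_eq_of_forall_row_eq_smul_add_const
      (Fin.append (fun _ => 0) fun j => -β j e) (Fin.castAdd k i) (by simp) fun a b => ?_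
    refine a.addCases (fun a => ?_) fun a => ?_ <;> simp [sub_eq_add_neg]
  | add a b ha hb => simpa using congrArg₂ (· + ·) ha hb
  | smul c a ha =>
    rw [wedge_smul_right, ← ha, ← wedge_smul_right]
    rfl

theorem wedge_covectorWedge_eq_zero_of_ker [FiniteDimensional ℂ W] {δ : Fin m → Dual ℂ W}
    {i : Fin m} {e : W} (he : δ i e = 1) {χ : Form W k}
    (hχ : ∀ v : Fin k → W, (∀ j, δ i (v j) = 0) → χ v = 0) :
    wedge (covectorWedge δ) χ = 0 := by
  have comp_eq_zero : χ.compLinearMap (LinearMap.id - (δ i).smulRight e) = 0 := by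
    ext v
    exact hχ _ fun j => by simp [he]
  rw [← wedge_covectorWedge_compLinearMap δ i e, comp_eq_zero]
  exact map_zero (wedgeₗ m k _)

theorem covectorMul_eq_zero_iff [FiniteDimensional ℂ W] {α : Dual ℂ W} {e : W} (he : α e = 1)
    {χ : Form W k} :
    covectorMul α χ = 0 ↔ ∀ v : Fin k → W, (∀ i, α (v i) = 0) → χ v = 0 := by
  refine ⟨fun h v hv => ?_, fun h => ?_⟩
  · have at_cons := congrArg (· (Fin.cons e v)) h
    simpa [covectorMul, AlternatingMap.alternatizeUncurryFin_apply, Fin.sum_univ_succ, he, hv]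
      using at_cons
  · ext v
    rw [covectorMul_apply_eq_wedge, wedge_covectorWedge_eq_zero_of_ker (i := 0) he h]
    rfl

theorem formDeriv_eq_alternatizeUncurryFin (F : End ℂ W) (a : Form W (k + 1)) :
    formDeriv F a = AlternatingMap.alternatizeUncurryFin (a.curryLeft ∘ₗ F) := by
  ext v
  rw [formDeriv_apply, AlternatingMap.alternatizeUncurryFin_apply]
  refine Finset.sum_congr rfl fun i _ => ?_
  rw [← Fin.insertNth_removeNth, AlternatingMap.map_insertNth]
  rfl

end CovectorMul

section LieExtDeriv

variable {𝔤 : Type*} [LieRing 𝔤] [LieAlgebra ℂ 𝔤] {k : ℕ}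

theorem lieExtDeriv_eq_neg_covectorMul {α : Dual ℂ 𝔤} {F : End ℂ 𝔤}
    (hF : ∀ x y : 𝔤, ⁅x, y⁆ = α x • F y - α y • F x) (Ψ : Form 𝔤 (k + 1)) (X : Fin (k + 2) → 𝔤) :
    lieExtDeriv Ψ X = -covectorMul α (formDeriv F Ψ) X := by
  let f : 𝔤 →ₗ[ℂ] 𝔤 →ₗ[ℂ] Form 𝔤 k := α.smulRight (Ψ.curryLeft ∘ₗ F)
  have bracket (x y : 𝔤) (v : Fin k → 𝔤) : f x y v - f y x v = Ψ (Fin.cons ⁅x, y⁆ v) := by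
    have := congrArg (· v) (map_sub Ψ.curryLeft (α x • F y) (α y • F x))
    rw [map_smul, map_smul, ← hF] at this
    exact this.symm
  have uncurry : AlternatingMap.alternatizeUncurryFinLM ∘ₗ f = α.smulRight (formDeriv F Ψ) := by
    ext x : 1
    simp [f, formDeriv_eq_alternatizeUncurryFin]
  rw [covectorMul, ← uncurry,
    AlternatingMap.alternatizeUncurryFin_alternatizeUncurryFinLM_comp_apply,
    lieExtDeriv, ← Finset.sum_neg_distrib]
  refine Finset.sum_congr rfl fun i _ => ?_
  rw [Fin.sum_univ_succ, if_neg (Fin.not_lt_zero _), zero_add, ← Finset.sum_neg_distrib,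
    ← Finset.filter_le_eq_Ici, Finset.sum_filter]
  refine Finset.sum_congr rfl fun j _ => ?_
  simp only [Fin.castSucc_lt_succ_iff, bracket, Fin.val_succ]
  refine if_ctx_congr Iff.rfl (fun hij => ?_) fun _ => rfl
  rw [Fin.removeNth_removeNth_eq_swap, Fin.succAbove_succ_of_le _ _ hij,
    Fin.predAbove_succ_of_le _ _ hij, ← add_assoc, pow_succ, zsmul_eq_mul]
  push_cast
  ring

theorem lieExtDeriv_eq_zero_iff [FiniteDimensional ℂ 𝔤] {α : Dual ℂ 𝔤} {F : End ℂ 𝔤}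
    (hF : ∀ x y : 𝔤, ⁅x, y⁆ = α x • F y - α y • F x) {e : 𝔤} (he : α e = 1)
    (Ψ : Form 𝔤 (k + 1)) :
    lieExtDeriv Ψ = 0 ↔
      ∀ v : Fin (k + 1) → 𝔤, (∀ i, α (v i) = 0) → formDeriv F Ψ v = 0 := by
  rw [← covectorMul_eq_zero_iff he, AlternatingMap.ext_iff, funext_iff]
  simp [lieExtDeriv_eq_neg_covectorMul hF]

end LieExtDeriv

section StandardForms

variable {W : Type*} [AddCommGroup W] [Module ℂ W] {k m n : ℕ}

/-- The index triples of the terms of `φ`: the lines of a Fano plane. -/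
def line : Fin 7 → Fin 3 → Fin 7 :=
  ![![0, 1, 6], ![2, 3, 6], ![4, 5, 6], ![0, 2, 4], ![0, 3, 5], ![1, 2, 5], ![1, 3, 4]]

/-- The complements of the lines, ordered so that the permutation
`Fin.append (line i) (coline i)` of the seven points is even. -/
def coline : Fin 7 → Fin 4 → Fin 7 :=
  ![![2, 3, 4, 5], ![0, 1, 4, 5], ![0, 1, 2, 3], ![1, 3, 6, 5], ![1, 2, 6, 4], ![0, 3, 6, 4],
    ![0, 2, 6, 5]]

/-- The sign with which a line occurs in `φ`, and its complement in `⋆φ`. -/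
def lineSign : Fin 7 → ℂ := ![1, 1, 1, 1, -1, -1, -1]

/-- The three-form `φ` of the `(G₂)_ℂ`-structure with adapted basis `E`. -/
def phiForm (E : Basis (Fin 7) ℂ W) : Form W 3 :=
  ∑ i, lineSign i • basisForm E (line i)

/-- The Hodge dual `⋆φ` of the `(G₂)_ℂ`-structure with adapted basis `E`. -/
def psiForm (E : Basis (Fin 7) ℂ W) : Form W 4 :=
  ∑ i, lineSign i • basisForm E (coline i)

/-- The volume form `E¹ ∧ … ∧ E⁷`. -/
def volForm (E : Basis (Fin 7) ℂ W) : Form W 7 :=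
  basisForm E ![0, 1, 2, 3, 4, 5, 6]

theorem basisForm_apply_basis (E : Basis (Fin n) ℂ W) {I : Fin m → Fin n}
    (hI : Function.Injective I) : basisForm E I (E ∘ I) = 1 := by
  rw [basisForm, covectorWedge_apply]
  convert Matrix.det_one (n := Fin m) (R := ℂ)
  ext i j
  simp [Matrix.one_apply, Finsupp.single_apply, hI.eq_iff, eq_comm]

theorem basisForm_id_apply_basis (E : Basis (Fin n) ℂ W) : basisForm E id E = 1 :=
  basisForm_apply_basis E Function.injective_id

theorem volForm_eq_basisForm_id (E : Basis (Fin 7) ℂ W) : volForm E = basisForm E id := by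
  have vec_eq_id : (![0, 1, 2, 3, 4, 5, 6] : Fin 7 → Fin 7) = id := by
    ext i; fin_cases i <;> rfl
  rw [volForm, vec_eq_id]

theorem volForm_apply_basis (E : Basis (Fin 7) ℂ W) : volForm E E = 1 := by
  rw [volForm_eq_basisForm_id, basisForm_id_apply_basis]

theorem volForm_ne_zero (E : Basis (Fin 7) ℂ W) : volForm E ≠ 0 := fun h =>
  one_ne_zero ((volForm_apply_basis E).symm.trans (by rw [h, AlternatingMap.zero_apply]))

theorem form_ext_basis (E : Basis (Fin n) ℂ W) {a b : Form W n} (h : a E = b E) : a = b := by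
  rw [a.eq_smul_basis_det E, b.eq_smul_basis_det E, h]

theorem eq_smul_volForm (E : Basis (Fin 7) ℂ W) (a : Form W 7) : a = a E • volForm E :=
  form_ext_basis E <| by
    rw [AlternatingMap.smul_apply, volForm_apply_basis, smul_eq_mul, mul_one]

theorem apply_basis_comp_of_even (E : Basis (Fin 7) ℂ W) (a : Form W 7) {s : Fin 7 → Fin 7}
    (hs : Function.Bijective s) (even : Equiv.Perm.sign (Equiv.ofBijective s hs) = 1) :
    a (E ∘ s) = a E :=
  (a.map_perm E (Equiv.ofBijective s hs)).trans (by rw [even, one_smul])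

theorem apply_basis_comp_append_line_coline (E : Basis (Fin 7) ℂ W) (a : Form W 7) (i : Fin 7) :
    a (E ∘ Fin.append (line i) (coline i)) = a E := by
  refine apply_basis_comp_of_even E a (by revert i; decide) ?_
  rw [Equiv.Perm.sign_eq_prod_prod_Iio]
  simp only [Equiv.ofBijective_apply]
  revert i
  decide

theorem apply_basis_comp_append_coline_line (E : Basis (Fin 7) ℂ W) (a : Form W 7) (i : Fin 7) :
    a (E ∘ Fin.append (coline i) (line i)) = a E := by
  refine apply_basis_comp_of_even E a (by revert i; decide) ?_
  rw [Equiv.Perm.sign_eq_prod_prod_Iio]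
  simp only [Equiv.ofBijective_apply]
  revert i
  decide

theorem line_injective (i : Fin 7) : Function.Injective (line i) := by revert i; decide

theorem coline_injective (i : Fin 7) : Function.Injective (coline i) := by revert i; decide

theorem line_ne_coline (i : Fin 7) (j : Fin 3) (l : Fin 4) : line i j ≠ coline i l := by
  revert i j l; decide

theorem comp_append {X Y : Type*} (f : X → Y) (v : Fin k → X) (w : Fin m → X) :
    f ∘ Fin.append v w = Fin.append (f ∘ v) (f ∘ w) := by
  ext i
  refine i.addCases (fun i => ?_) fun i => ?_ <;> simp

theorem basisForm_wedge_apply_basis [FiniteDimensional ℂ W] (E : Basis (Fin n) ℂ W)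
    {L : Fin k → Fin n} {M : Fin m → Fin n} (hL : Function.Injective L) (hLM : ∀ i j, L i ≠ M j)
    (χ : Form W m) : wedge (basisForm E L) χ (E ∘ Fin.append L M) = χ (E ∘ M) := by
  rw [comp_append, basisForm, covectorWedge_wedge_apply_append _
    (by simpa [Finsupp.single_apply, eq_comm] using hLM), ← basisForm, basisForm_apply_basis E hL,
    one_mul]

theorem wedge_basisForm_apply_basis [FiniteDimensional ℂ W] (E : Basis (Fin n) ℂ W)
    {L : Fin k → Fin n} {M : Fin m → Fin n} (hL : Function.Injective L) (hLM : ∀ i j, L i ≠ M j)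
    (χ : Form W m) : wedge χ (basisForm E L) (E ∘ Fin.append M L) = χ (E ∘ M) := by
  rw [comp_append, basisForm, wedge_covectorWedge_apply_append _
    (by simpa [Finsupp.single_apply, eq_comm] using hLM), ← basisForm, basisForm_apply_basis E hL,
    mul_one]

theorem phiForm_wedge [FiniteDimensional ℂ W] (E : Basis (Fin 7) ℂ W) (χ : Form W 4) :
    wedge (phiForm E) χ = (∑ i, lineSign i * χ (E ∘ coline i)) • volForm E := by
  have term (i : Fin 7) : wedge (basisForm E (line i)) χ = χ (E ∘ coline i) • volForm E := by
    rw [← basisForm_wedge_apply_basis E (line_injective i) (line_ne_coline i)]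
    exact (eq_smul_volForm E _).trans (by rw [← apply_basis_comp_append_line_coline E _ i])
  simp only [phiForm, wedge_sum_left, wedge_smul_left, term, smul_smul, Finset.sum_smul]

theorem wedge_phiForm [FiniteDimensional ℂ W] (E : Basis (Fin 7) ℂ W) (χ : Form W 4) :
    wedge χ (phiForm E) = (∑ i, lineSign i * χ (E ∘ coline i)) • volForm E := by
  have term (i : Fin 7) : wedge χ (basisForm E (line i)) = χ (E ∘ coline i) • volForm E := by
    rw [← wedge_basisForm_apply_basis E (line_injective i) (line_ne_coline i)]
    exact (eq_smul_volForm E _).trans (by rw [← apply_basis_comp_append_coline_line E _ i])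
  simp only [phiForm, wedge_sum_right, wedge_smul_right, term, smul_smul, Finset.sum_smul]

theorem wedge_psiForm [FiniteDimensional ℂ W] (E : Basis (Fin 7) ℂ W) (a : Form W 3) :
    wedge a (psiForm E) = (∑ i, lineSign i * a (E ∘ line i)) • volForm E := by
  have term (i : Fin 7) : wedge a (basisForm E (coline i)) = a (E ∘ line i) • volForm E := by
    rw [← wedge_basisForm_apply_basis E (coline_injective i) fun j l => (line_ne_coline i l j).symm]
    exact (eq_smul_volForm E _).trans (by rw [← apply_basis_comp_append_line_coline E _ i])
  simp only [psiForm, wedge_sum_right, wedge_smul_right, term, smul_smul, Finset.sum_smul]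

theorem covectorWedge_orthoForm_wedge_psiForm [FiniteDimensional ℂ W] (E : Basis (Fin 7) ℂ W)
    (v : Fin 3 → W) :
    wedge (covectorWedge fun k => orthoForm E (v k)) (psiForm E) = phiForm E v • volForm E := by
  rw [wedge_psiForm, phiForm, form_sum_apply]
  congr 1
  refine Finset.sum_congr rfl fun i _ => ?_
  rw [AlternatingMap.smul_apply, smul_eq_mul, basisForm, covectorWedge_apply,
    covectorWedge_apply, ← Matrix.det_transpose]
  congr 2
  ext j l
  simp [← orthoForm_basis_left, orthoForm_comm E (v l)]

theorem phiForm_apply (E : Basis (Fin 7) ℂ W) (x y z : W) :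
    phiForm E ![x, y, z] = ∑ i, lineSign i *
      (E.coord (line i 0) x * (E.coord (line i 1) y * E.coord (line i 2) z
          - E.coord (line i 1) z * E.coord (line i 2) y)
        - E.coord (line i 0) y * (E.coord (line i 1) x * E.coord (line i 2) z
          - E.coord (line i 1) z * E.coord (line i 2) x)
        + E.coord (line i 0) z * (E.coord (line i 1) x * E.coord (line i 2) y
          - E.coord (line i 1) y * E.coord (line i 2) x)) := by
  rw [phiForm, form_sum_apply]
  refine Finset.sum_congr rfl fun i _ => ?_
  rw [AlternatingMap.smul_apply, smul_eq_mul, basisForm, covectorWedge_apply,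
    Matrix.det_fin_three]
  simp only [Matrix.of_apply, Matrix.cons_val]
  ring

theorem isInducedForm_orthoForm [FiniteDimensional ℂ W] (E : Basis (Fin 7) ℂ W) :
    IsInducedForm (phiForm E) (volForm E) (orthoForm E) := by
  intro v w
  have coeff : ∑ i, lineSign i *
      wedge (interior v (phiForm E)) (interior w (phiForm E)) (E ∘ coline i) =
        6 * orthoForm E v w := by
    have comp_coline (i : Fin 7) : (E ∘ coline i : Fin 4 → W) =
        ![E (coline i 0), E (coline i 1), E (coline i 2), E (coline i 3)] := by
      ext j; fin_cases j <;> rfl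
    have interior_apply (u x y : W) :
        interior u (phiForm E) ![x, y] = phiForm E ![u, x, y] := rfl
    simp only [comp_coline]
    simp only [wedge_two_two_apply, interior_apply, phiForm_apply, orthoForm_apply,
      Fin.sum_univ_seven, lineSign, line, coline, Matrix.cons_val, Basis.coord_apply,
      Basis.repr_self, Finsupp.single_apply, Fin.reduceEq, if_true, if_false]
    ring
  have := wedge_phiForm E (wedge (interior v (phiForm E)) (interior w (phiForm E)))
  rw [coeff] at this
  refine .trans ?_ (congrArg ((1 / 6 : ℂ) • ·) this.symm)
  rw [smul_smul]
  congr 1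
  ring

theorem IsInducedForm.eq_orthoForm [FiniteDimensional ℂ W] {E : Basis (Fin 7) ℂ W}
    {B : LinearMap.BilinForm ℂ W} (h : IsInducedForm (phiForm E) (volForm E) B) :
    B = orthoForm E :=
  h.unique (volForm_ne_zero E) (isInducedForm_orthoForm E)

theorem formInner_basisForm_left [FiniteDimensional ℂ W] (E : Basis (Fin n) ℂ W)
    (I : Fin m → Fin n) (χ : Form W m) :
    formInner (orthoForm E) (orthoForm_nondegenerate E) (basisForm E I) χ = χ (E ∘ I) := by
  simp only [basisForm, ← orthoForm_basis_left]
  exact formInner_flat_left _ _ (E ∘ I) χ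

theorem formInner_sum_smul_left [FiniteDimensional ℂ W] {B : LinearMap.BilinForm ℂ W}
    (hB : B.Nondegenerate) {ι : Type*} (s : Finset ι) (c : ι → ℂ) (a : ι → Form W m)
    (χ : Form W m) :
    formInner B hB (∑ i ∈ s, c i • a i) χ = ∑ i ∈ s, c i * formInner B hB (a i) χ := by
  simp only [formInner, form_sum_apply, AlternatingMap.smul_apply, smul_eq_mul, Finset.sum_mul]
  rw [Finset.sum_comm, Finset.mul_sum]
  simp only [Finset.mul_sum, mul_left_comm, mul_assoc]

theorem formInner_comm [FiniteDimensional ℂ W] {B : LinearMap.BilinForm ℂ W}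
    (hB : B.Nondegenerate) (hs : ∀ v w, B v w = B w v) (a c : Form W m) :
    formInner B hB a c = formInner B hB c a := by
  conv_rhs => rw [form_eq_sum_covectorWedge hB hs c, Finset.smul_sum]
  simp only [smul_smul, formInner_sum_smul_left, formInner_flat_left]
  simp only [formInner, Finset.mul_sum]
  exact Finset.sum_congr rfl fun I _ => by ring

theorem phiForm_wedge_eq_formInner_smul [FiniteDimensional ℂ W] (E : Basis (Fin 7) ℂ W)
    (χ : Form W 4) :
    wedge (phiForm E) χ =
      formInner (orthoForm E) (orthoForm_nondegenerate E) (psiForm E) χ • volForm E := by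
  simp only [phiForm_wedge, psiForm, formInner_sum_smul_left, formInner_basisForm_left]

theorem isHodgeDual_phiForm_iff [FiniteDimensional ℂ W] (E : Basis (Fin 7) ℂ W) (Ψ : Form W 4) :
    IsHodgeDual (phiForm E) (volForm E) Ψ ↔ Ψ = psiForm E := by
  refine ⟨fun ⟨B, hB, induced, hodge⟩ => ?_, ?_⟩
  · obtain rfl := induced.eq_orthoForm
    have inner_eq (χ) : formInner (orthoForm E) hB Ψ χ = formInner (orthoForm E) hB (psiForm E) χ :=
      smul_left_injective ℂ (volForm_ne_zero E)
        ((hodge χ).symm.trans (phiForm_wedge_eq_formInner_smul E χ))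
    ext v
    rw [← formInner_flat_left _ hB, ← formInner_flat_left _ hB,
      formInner_comm hB (orthoForm_comm E), inner_eq, formInner_comm hB (orthoForm_comm E)]
  · rintro rfl
    exact ⟨orthoForm E, orthoForm_nondegenerate E, isInducedForm_orthoForm E,
      phiForm_wedge_eq_formInner_smul E⟩

theorem isG2Structure_iff (φ : Form W 3) (vol : Form W 7) :
    IsG2Structure φ vol ↔ ∃ E : Basis (Fin 7) ℂ W, vol = volForm E ∧ φ = phiForm E := by
  refine exists_congr fun E => and_congr Iff.rfl ?_
  simp [phiForm, Fin.sum_univ_seven, line, lineSign, sub_eq_add_neg]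

end StandardForms

theorem isCocalibratedG2Structure_iff {𝔤 : Type*} [LieRing 𝔤] [LieAlgebra ℂ 𝔤]
    [FiniteDimensional ℂ 𝔤] (φ : Form 𝔤 3) (vol : Form 𝔤 7) :
    IsCocalibratedG2Structure φ vol ↔ ∃ E : Basis (Fin 7) ℂ 𝔤,
      vol = volForm E ∧ φ = phiForm E ∧ lieExtDeriv (psiForm E) = 0 := by
  rw [IsCocalibratedG2Structure, isG2Structure_iff]
  constructor
  · rintro ⟨⟨E, rfl, rfl⟩, Ψ, hodge, closed⟩
    rw [isHodgeDual_phiForm_iff] at hodge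
    exact ⟨E, rfl, rfl, hodge ▸ closed⟩
  · rintro ⟨E, rfl, rfl, closed⟩
    exact ⟨⟨E, rfl, rfl⟩, psiForm E, (isHodgeDual_phiForm_iff E _).2 rfl, closed⟩

section ConformalEnd

variable {K V V' : Type*} [Field K] [AddCommGroup V] [Module K V] [AddCommGroup V'] [Module K V']
variable {ω : LinearMap.BilinForm K V} {ω' : LinearMap.BilinForm K V'}

/-- `f` is infinitesimally conformal for the bilinear form `ω`, with factor `c`. Factor `0` gives
the Lie algebra of the isometry group of `ω`. -/
def IsConformalEnd (ω : LinearMap.BilinForm K V) (f : End K V) (c : K) : Prop :=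
  ∀ x y, ω (f x) y + ω x (f y) = c * ω x y

theorem mem_skewAdjointLieSubalgebra_iff {f : End K V} :
    f ∈ skewAdjointLieSubalgebra ω ↔ IsConformalEnd ω f 0 := by
  change f ∈ LinearMap.skewAdjointSubmodule ω ↔ _
  simp only [LinearMap.mem_skewAdjointSubmodule, LinearMap.IsSkewAdjoint, LinearMap.IsAdjointPair,
    Pi.neg_apply, map_neg, eq_neg_iff_add_eq_zero, IsConformalEnd, zero_mul]

theorem IsConformalEnd.add_smul_id {f : End K V} {c : K} (hf : IsConformalEnd ω f c) (a : K) :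
    IsConformalEnd ω (f + a • LinearMap.id) (c + 2 * a) := fun x y => by
  simp only [LinearMap.add_apply, LinearMap.smul_apply, LinearMap.id_apply, map_add, map_smul,
    smul_eq_mul]
  linear_combination hf x y

theorem IsConformalEnd.conj {f : End K V} {c : K} (hf : IsConformalEnd ω f c) (t : V ≃ₗ[K] V')
    (ht : ∀ x y, ω' (t x) (t y) = ω x y) : IsConformalEnd ω' (t.conj f) c := fun x y => by
  have h := hf (t.symm x) (t.symm y)
  simp only [← ht, LinearEquiv.apply_symm_apply] at h
  exact h

/-- Read through `ω : V ≃ V*`, conformality says that `f` is conjugate to `c - f*`. -/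
theorem IsConformalEnd.two_mul_trace [FiniteDimensional K V] (hω : ω.Nondegenerate) {f : End K V}
    {c : K} (hf : IsConformalEnd ω f c) : 2 * LinearMap.trace K V f = c * finrank K V := by
  have hconj : (ω.toDual hω).conj f + Dual.transpose (R := K) f = c • LinearMap.id := by
    ext φ y
    obtain ⟨x, rfl⟩ := (ω.toDual hω).surjective φ
    simp only [LinearEquiv.conj_apply_apply, LinearEquiv.symm_apply_apply, LinearMap.add_apply,
      LinearMap.smul_apply, LinearMap.id_apply, Dual.transpose_apply, LinearMap.comp_apply,
      LinearMap.BilinForm.toDual_def, smul_eq_mul]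
    linear_combination hf x y
  have htr := congrArg (LinearMap.trace K _) hconj
  rw [map_add, map_smul, LinearMap.trace_conj', LinearMap.trace_transpose', LinearMap.trace_id,
    Subspace.dual_finrank_eq, smul_eq_mul] at htr
  linear_combination htr

end ConformalEnd

section SymplecticClassification

variable {K V V' : Type*} [Field K] [AddCommGroup V] [Module K V] [AddCommGroup V'] [Module K V']
variable {ω : LinearMap.BilinForm K V} {ω' : LinearMap.BilinForm K V'}

/-- The orthogonal complement of the span of two vectors. -/
def pairPerp (ω : LinearMap.BilinForm K V) (e f : V) : Submodule K V :=
  LinearMap.ker (ω e) ⊓ LinearMap.ker (ω f)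

theorem exists_hyperbolic_pair [Nontrivial V] (hω : ω.Nondegenerate) : ∃ e f, ω e f = 1 := by
  obtain ⟨e, he⟩ := exists_ne (0 : V)
  obtain ⟨f, hf⟩ : ∃ f, ω e f ≠ 0 := by
    by_contra! h
    exact he (hω.1 e h)
  exact ⟨e, (ω e f)⁻¹ • f, by rw [map_smul, smul_eq_mul, inv_mul_cancel₀ hf]⟩

/-- The decomposition of `V` into a hyperbolic plane and its orthogonal complement; the plane is
identified with `K × K` by the coordinates `(-ω f, ω e)` in the basis `(e, f)`. -/
def hyperbolicSplit (hω : ω.IsAlt) {e f : V} (h : ω e f = 1) :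
    V ≃ₗ[K] (K × K) × pairPerp ω e f where
  toFun x := ((-ω f x, ω e x), ⟨x + ω f x • e - ω e x • f, by
    simp [pairPerp, h, ← hω.neg_eq e f, hω.self_eq_zero]⟩)
  map_add' x y := by
    ext <;> simp only [map_add, Prod.fst_add, Prod.snd_add, Submodule.coe_add]
    · ring
    · module
  map_smul' c x := by
    ext <;> simp only [map_smul, Prod.smul_fst, Prod.smul_snd, SetLike.val_smul, smul_eq_mul,
      RingHom.id_apply]
    · ring
    · module
  invFun p := p.1.1 • e + p.1.2 • f + p.2
  left_inv x := by
    simp only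
    module
  right_inv := by
    rintro ⟨⟨a, b⟩, k, hk⟩
    obtain ⟨hek, hfk⟩ := Submodule.mem_inf.1 hk
    rw [LinearMap.mem_ker] at hek hfk
    ext <;> simp only [map_add, map_smul, smul_eq_mul, h, ← hω.neg_eq e f, hω.self_eq_zero, hek,
      hfk, mul_neg, mul_one, mul_zero, add_zero, zero_add, neg_neg]
    module

theorem apply_eq_hyperbolicSplit (hω : ω.IsAlt) {e f : V} (h : ω e f = 1) (x y : V) :
    ω x y = (hyperbolicSplit hω h x).1.1 * (hyperbolicSplit hω h y).1.2
      - (hyperbolicSplit hω h x).1.2 * (hyperbolicSplit hω h y).1.1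
      + ω (hyperbolicSplit hω h x).2 (hyperbolicSplit hω h y).2 := by
  simp only [hyperbolicSplit, LinearEquiv.coe_mk, LinearMap.coe_mk, AddHom.coe_mk, map_sub, map_add,
    map_smul, LinearMap.sub_apply, LinearMap.add_apply, LinearMap.smul_apply, smul_eq_mul, h,
    ← hω.neg_eq e f, ← hω.neg_eq e x, ← hω.neg_eq f x, hω.self_eq_zero]
  ring

theorem nondegenerate_restrict_pairPerp (hω : ω.IsAlt) (hn : ω.Nondegenerate) {e f : V}
    (h : ω e f = 1) : (ω.restrict (pairPerp ω e f)).Nondegenerate := by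
  have halt : (ω.restrict (pairPerp ω e f)).IsAlt := fun x => hω x
  rw [LinearMap.BilinForm.Nondegenerate, halt.isRefl.nondegenerate_iff_separatingLeft]
  intro x hx
  obtain ⟨hex, hfx⟩ := Submodule.mem_inf.1 x.2
  rw [LinearMap.mem_ker] at hex hfx
  have hsplit : hyperbolicSplit hω h x = (0, x) := by
    ext <;> simp [hyperbolicSplit, hex, hfx]
  refine Subtype.ext (hn.1 _ fun y => ?_)
  rw [apply_eq_hyperbolicSplit hω h, hsplit]
  simpa using hx _

/-- Linear Darboux theorem. -/
theorem exists_symplectic_equiv [FiniteDimensional K V] [FiniteDimensional K V'] (hω : ω.IsAlt)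
    (hω' : ω'.IsAlt) (hn : ω.Nondegenerate) (hn' : ω'.Nondegenerate)
    (hd : finrank K V = finrank K V') :
    ∃ t : V ≃ₗ[K] V', ∀ x y, ω' (t x) (t y) = ω x y := by
  induction hdim : finrank K V using Nat.strong_induction_on generalizing V V' with
  | _ d ih =>
    rcases Nat.eq_zero_or_pos d with rfl | hpos
    · have := Module.finrank_zero_iff.1 hdim
      exact ⟨LinearEquiv.ofFinrankEq V V' hd, fun x y => by simp [Subsingleton.elim x 0]⟩
    have : Nontrivial V := Module.finrank_pos_iff.1 (hdim ▸ hpos)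
    have : Nontrivial V' := Module.finrank_pos_iff.1 (hd ▸ hdim ▸ hpos)
    obtain ⟨e, f, h⟩ := exists_hyperbolic_pair hn
    obtain ⟨e', f', h'⟩ := exists_hyperbolic_pair hn'
    have hsplit := (hyperbolicSplit hω h).finrank_eq
    have hsplit' := (hyperbolicSplit hω' h').finrank_eq
    rw [finrank_prod, finrank_prod, finrank_self] at hsplit hsplit'
    obtain ⟨t, ht⟩ := ih (d - 2) (by lia) (ω := ω.restrict (pairPerp ω e f))
      (ω' := ω'.restrict (pairPerp ω' e' f')) (fun x => hω x) (fun x => hω' x)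
      (nondegenerate_restrict_pairPerp hω hn h) (nondegenerate_restrict_pairPerp hω' hn' h')
      (by lia) (by lia)
    refine ⟨hyperbolicSplit hω h ≪≫ₗ (LinearEquiv.refl K (K × K)).prodCongr t ≪≫ₗ
      (hyperbolicSplit hω' h').symm, fun x y => ?_⟩
    rw [apply_eq_hyperbolicSplit hω' h', apply_eq_hyperbolicSplit hω h]
    simp only [LinearEquiv.trans_apply, LinearEquiv.apply_symm_apply]
    exact congrArg _ (ht _ _)

end SymplecticClassification

section Descent

variable {K V W : Type*} [Field K] [AddCommGroup V] [Module K V] [AddCommGroup W] [Module K W]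
variable {B : LinearMap.BilinForm K W}

theorem exists_bilinForm_range_of_isAlt {N : End K W} (hB : B.Nondegenerate)
    (hN : (B ∘ₗ N).IsAlt) :
    ∃ σ : LinearMap.BilinForm K (LinearMap.range N), σ.IsAlt ∧ σ.Nondegenerate ∧
      ∀ (s : LinearMap.range N) x, B s x = σ s (N.rangeRestrict x) := by
  obtain ⟨r, hr⟩ := N.rangeRestrict.exists_rightInverse_of_surjective N.range_rangeRestrict
  replace hr (s : LinearMap.range N) : N (r s) = s :=
    congrArg Subtype.val (LinearMap.congr_fun hr s)
  have hσ (s : LinearMap.range N) (x : W) : B s x = B s (r (N.rangeRestrict x)) := by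
    obtain ⟨_, y, rfl⟩ := s
    change (B ∘ₗ N) y x = (B ∘ₗ N) y (r (N.rangeRestrict x))
    rw [← LinearMap.IsAlt.neg hN, ← LinearMap.IsAlt.neg hN _ y, LinearMap.comp_apply,
      LinearMap.comp_apply, hr]
    rfl
  have halt : (B.compl₁₂ (LinearMap.range N).subtype r).IsAlt := fun s => by
    change B s (r s) = 0
    rw [← hr s]
    exact hN (r s)
  refine ⟨B.compl₁₂ (LinearMap.range N).subtype r, halt, ?_, hσ⟩
  rw [LinearMap.BilinForm.Nondegenerate, halt.isRefl.nondegenerate_iff_separatingLeft]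
  exact fun s hs => Subtype.ext (hB.1 s fun x => (hσ s x).trans (hs _))

/-- The conformality of `σ ∘ (p × p)` under `G` says that `F j p = j p (c - G)`, as the relation
between `B`, `σ`, `j` and `p` makes `j p` skew for `B`. -/
theorem isConformalEnd_compl₁₂_iff {σ : LinearMap.BilinForm K V} {p : W →ₗ[K] V} {j : V →ₗ[K] W}
    {F G : End K W} {c : K} (hB : B.Nondegenerate) (hsymm : B.IsSymm) (hσ : σ.IsAlt)
    (hp : Function.Surjective p) (hj : ∀ s x, B (j s) x = σ s (p x))
    (hG : LinearMap.IsAdjointPair B B G F) :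
    IsConformalEnd (σ.compl₁₂ p p) G c ↔
      ∃ f : End K V, F ∘ₗ j = j ∘ₗ f ∧ IsConformalEnd σ f c := by
  have hadj (x y : W) : B (F (j (p x))) y = σ (p x) (p (G y)) := by
    rw [hsymm.eq, ← hG, hsymm.eq, hj]
  constructor
  · intro h
    replace h (x y : W) : σ (p (G x)) (p y) + σ (p x) (p (G y)) = c * σ (p x) (p y) := h x y
    obtain ⟨r, hr⟩ := p.exists_rightInverse_of_surjective (LinearMap.range_eq_top.2 hp)
    replace hr (s : V) : p (r s) = s := LinearMap.congr_fun hr s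
    refine ⟨c • LinearMap.id - p ∘ₗ G ∘ₗ r, ?_, fun s t => ?_⟩
    · ext s
      refine sub_eq_zero.1 (hB.1 _ fun y => ?_)
      have := h (r s) y
      rw [← hadj, hr] at this
      simp only [LinearMap.comp_apply, LinearMap.sub_apply, LinearMap.smul_apply,
        LinearMap.id_apply, map_sub, map_smul, hj, smul_eq_mul]
      linear_combination this
    · have := h (r s) (r t)
      rw [hr, hr] at this
      simp only [LinearMap.comp_apply, LinearMap.sub_apply, LinearMap.smul_apply,
        LinearMap.id_apply, map_sub, map_smul, smul_eq_mul]
      linear_combination -this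
  · rintro ⟨f, hFj, hf⟩ x y
    replace hFj (s : V) : F (j s) = j (f s) := LinearMap.congr_fun hFj s
    have hleft (x y : W) : σ (p x) (p (G y)) = σ (f (p x)) (p y) := by rw [← hadj, hFj, hj]
    have := hf (p x) (p y)
    simp only [LinearMap.compl₁₂_apply]
    rw [← hσ.neg_eq, hleft, hleft, hσ.neg_eq, ← this, add_comm]

end Descent

section ConformalSubspace

variable {K U V : Type*} [Field K] [AddCommGroup U] [Module K U] [AddCommGroup V] [Module K V]

/-- `f` preserves a `d`-dimensional subspace carrying a symplectic form for which the restriction of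
`f` is conformal with factor `tr f` (the trace on the whole space). -/
def HasTraceConformalSubspace (f : End K U) (d : ℕ) : Prop :=
  ∃ (S : Submodule K U) (σ : LinearMap.BilinForm K S) (g : End K S), finrank K S = d ∧ σ.IsAlt ∧
    σ.Nondegenerate ∧ f ∘ₗ S.subtype = S.subtype ∘ₗ g ∧ IsConformalEnd σ g (LinearMap.trace K U f)

theorem HasTraceConformalSubspace.of_injective {f : End K U} {j : V →ₗ[K] U}
    (hj : Function.Injective j) {σ : LinearMap.BilinForm K V} (hσ : σ.IsAlt)
    (hn : σ.Nondegenerate) {g : End K V} (hjg : f ∘ₗ j = j ∘ₗ g)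
    (hg : IsConformalEnd σ g (LinearMap.trace K U f)) :
    HasTraceConformalSubspace f (finrank K V) := by
  let t := LinearEquiv.ofInjective j hj
  refine ⟨LinearMap.range j, LinearMap.BilinForm.congr t σ, t.conj g, t.finrank_eq.symm,
    fun s => hσ _, hn.congr t, ?_, hg.conj t fun x y => by simp⟩
  refine LinearMap.ext fun s => ?_
  obtain ⟨x, rfl⟩ := t.surjective s
  simpa [t, LinearEquiv.conj_apply_apply] using LinearMap.congr_fun hjg x

theorem exists_linearEquiv_comp_eq {W W' : Type*} [AddCommGroup W] [Module K W]
    [AddCommGroup W'] [Module K W'] [FiniteDimensional K W] [FiniteDimensional K W']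
    (h : finrank K W = finrank K W') {i : V →ₗ[K] W} {i' : V →ₗ[K] W'}
    (hi : Function.Injective i) (hi' : Function.Injective i') :
    ∃ T : W ≃ₗ[K] W', T.toLinearMap ∘ₗ i = i' := by
  let T₀ := LinearEquiv.ofFinrankEq W W' h
  have hi₀ : Function.Injective (T₀.toLinearMap ∘ₗ i) := T₀.injective.comp hi
  obtain ⟨T₁, hT₁⟩ := Submodule.exists_linearEquiv_restrict_eq
    ((LinearEquiv.ofInjective _ hi₀).symm ≪≫ₗ LinearEquiv.ofInjective i' hi')
  refine ⟨T₀ ≪≫ₗ T₁, LinearMap.ext fun x => ?_⟩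
  have := hT₁ (LinearEquiv.ofInjective _ hi₀ x)
  simpa using this.symm

theorem hasTraceConformalSubspace_iff_exists_conj [FiniteDimensional K U] [FiniteDimensional K V]
    {i : V →ₗ[K] U} (hi : Function.Injective i) {ω : LinearMap.BilinForm K V} (hω : ω.IsAlt)
    (hn : ω.Nondegenerate) {f : End K U} :
    HasTraceConformalSubspace f (finrank K V) ↔ ∃ (T : U ≃ₗ[K] U) (g : End K V),
      T.conj f ∘ₗ i = i ∘ₗ g ∧ IsConformalEnd ω g (LinearMap.trace K U (T.conj f)) := by
  constructor
  · rintro ⟨S, σ, g, hS, hσ, hσn, hfg, hg⟩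
    obtain ⟨t, ht⟩ := exists_symplectic_equiv hσ hω hσn hn hS
    obtain ⟨T, hT⟩ := exists_linearEquiv_comp_eq (i := S.subtype) (i' := i ∘ₗ t.toLinearMap) rfl
      S.subtype_injective (hi.comp t.injective)
    refine ⟨T, t.conj g, LinearMap.ext fun x => ?_, ?_⟩
    · obtain ⟨x, rfl⟩ := t.surjective x
      have hTS (s : S) : T s = i (t s) := LinearMap.congr_fun hT s
      have hfS : f x = g x := LinearMap.congr_fun hfg x
      simp only [LinearMap.comp_apply, ← hTS, LinearEquiv.conj_apply_apply,
        LinearEquiv.symm_apply_apply, hfS]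
    · rw [LinearMap.trace_conj']
      exact hg.conj t ht
  · rintro ⟨T, g, hTg, hg⟩
    rw [LinearMap.trace_conj'] at hg
    refine .of_injective (j := T.symm.toLinearMap ∘ₗ i) (T.symm.injective.comp hi) hω hn ?_ hg
    refine LinearMap.ext fun x => T.injective ?_
    simpa [LinearEquiv.conj_apply_apply] using LinearMap.congr_fun hTg x

end ConformalSubspace

section NormalForms

variable {U : Type*} [AddCommGroup U] [Module ℂ U] [FiniteDimensional ℂ U]

theorem mem_skewAdjointLieSubalgebra_iff_isConformalEnd_trace {ω : LinearMap.BilinForm ℂ U}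
    (hn : ω.Nondegenerate) (hU : finrank ℂ U = 6) {f : End ℂ U} :
    f ∈ skewAdjointLieSubalgebra ω ↔ IsConformalEnd ω f (LinearMap.trace ℂ U f) := by
  suffices ∀ c, IsConformalEnd ω f c → (c = 0 ↔ c = LinearMap.trace ℂ U f) by
    rw [mem_skewAdjointLieSubalgebra_iff]
    exact ⟨fun h => (this 0 h).1 rfl ▸ h, fun h => (this _ h).2 rfl ▸ h⟩
  intro c hf
  have htr := hf.two_mul_trace hn
  rw [hU, Nat.cast_ofNat] at htr
  constructor <;> intro hc
  · linear_combination (-1 / 2) * htr + (-2) * hc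
  · linear_combination (-1 / 4) * htr + (-1 / 2) * hc

theorem trace_eq_add_of_comp_subtype {V₂ V₄ : Submodule ℂ U} (hV : IsCompl V₂ V₄) {f : End ℂ U}
    {g : End ℂ V₄} (hfg : f ∘ₗ V₄.subtype = V₄.subtype ∘ₗ g) :
    LinearMap.trace ℂ U f = LinearMap.trace ℂ V₂ (V₂.projectionOnto V₄ hV ∘ₗ f ∘ₗ V₂.subtype)
      + LinearMap.trace ℂ V₄ g := by
  have hg : g = V₄.projectionOnto V₂ hV.symm ∘ₗ f ∘ₗ V₄.subtype := by
    rw [hfg]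
    ext x
    simp
  conv_rhs => rw [hg]
  rw [← LinearMap.trace_comp_comm' (V₂.projectionOnto V₄ hV) (f ∘ₗ V₂.subtype),
    ← LinearMap.trace_comp_comm' (V₄.projectionOnto V₂ hV.symm) (f ∘ₗ V₄.subtype), ← map_add]
  congr 1
  ext x
  simp only [LinearMap.add_apply, LinearMap.comp_apply, Submodule.subtype_apply, ← map_add,
    Submodule.coe_projectionOnto_apply, Submodule.projection_add_projection_eq_self hV]

theorem mem_lengthTwoStabilizer_iff {V₂ V₄ : Submodule ℂ U} (hV : IsCompl V₂ V₄)
    (hV₄ : finrank ℂ V₄ = 4) {ω : LinearMap.BilinForm ℂ V₄} (hn : ω.Nondegenerate) {f : End ℂ U} :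
    f ∈ lengthTwoStabilizer V₂ V₄ ω ↔ ∃ g : End ℂ V₄,
      f ∘ₗ V₄.subtype = V₄.subtype ∘ₗ g ∧ IsConformalEnd ω g (LinearMap.trace ℂ U f) := by
  constructor
  · rintro ⟨f₂, h, f₄, hf₄, hfV₂, hfV₄⟩
    rw [mem_skewAdjointLieSubalgebra_iff] at hf₄
    set a := -(LinearMap.trace ℂ V₂ f₂ / 2) with ha
    have hg := hf₄.add_smul_id a
    have hfg : f ∘ₗ V₄.subtype = V₄.subtype ∘ₗ (f₄ + a • LinearMap.id) := by
      ext v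
      simp [hfV₄, add_comm]
    have hf₂ : V₂.projectionOnto V₄ hV ∘ₗ f ∘ₗ V₂.subtype = f₂ := by
      ext v
      simp [hfV₂]
    have htr₄ := hg.two_mul_trace hn
    rw [hV₄, Nat.cast_ofNat] at htr₄
    have htr := trace_eq_add_of_comp_subtype hV hfg
    rw [hf₂] at htr
    have hc : LinearMap.trace ℂ U f = 0 + 2 * a := by
      linear_combination htr + (1 / 2) * htr₄ + (-2) * ha
    exact ⟨_, hfg, hc ▸ hg⟩
  · rintro ⟨g, hfg, hg⟩
    have htr₄ := hg.two_mul_trace hn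
    rw [hV₄, Nat.cast_ofNat] at htr₄
    have htr := trace_eq_add_of_comp_subtype hV hfg
    set f₂ := V₂.projectionOnto V₄ hV ∘ₗ f ∘ₗ V₂.subtype
    set a := -(LinearMap.trace ℂ V₂ f₂ / 2) with ha
    have hc : LinearMap.trace ℂ U f + 2 * -a = 0 := by
      linear_combination -htr + (-1 / 2) * htr₄ + (-2) * ha
    refine ⟨f₂, V₄.projectionOnto V₂ hV.symm ∘ₗ f ∘ₗ V₂.subtype, g + (-a) • LinearMap.id,
      mem_skewAdjointLieSubalgebra_iff.2 (hc ▸ hg.add_smul_id (-a)), fun v => ?_, fun v => ?_⟩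
    · exact (Submodule.projection_add_projection_eq_self hV (f v)).symm
    · have hfv : f v = g v := LinearMap.congr_fun hfg v
      rw [hfv, LinearMap.add_apply, LinearMap.smul_apply, LinearMap.id_apply, Submodule.coe_add,
        SetLike.val_smul]
      module

theorem hasTraceConformalSubspace_six_iff (hU : finrank ℂ U = 6) {ω : LinearMap.BilinForm ℂ U}
    (hω : ω.IsAlt) (hn : ω.Nondegenerate) {f : End ℂ U} :
    HasTraceConformalSubspace f 6 ↔ IsSimilarToElementOf f (skewAdjointLieSubalgebra ω) := by
  rw [← hU, hasTraceConformalSubspace_iff_exists_conj (i := LinearMap.id) Function.injective_id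
    hω hn]
  refine exists_congr fun T => ?_
  rw [SetLike.mem_coe, mem_skewAdjointLieSubalgebra_iff_isConformalEnd_trace hn hU]
  simp

theorem hasTraceConformalSubspace_four_iff {V₂ V₄ : Submodule ℂ U} (hV : IsCompl V₂ V₄)
    (hV₄ : finrank ℂ V₄ = 4) {ω : LinearMap.BilinForm ℂ V₄} (hω : ω.IsAlt) (hn : ω.Nondegenerate)
    {f : End ℂ U} :
    HasTraceConformalSubspace f 4 ↔ IsSimilarToElementOf f (lengthTwoStabilizer V₂ V₄ ω) := by
  rw [← hV₄, hasTraceConformalSubspace_iff_exists_conj V₄.subtype_injective hω hn]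
  exact exists_congr fun T => (mem_lengthTwoStabilizer_iff hV hV₄ hn).symm

end NormalForms

section CrossProduct

variable {W : Type*} [AddCommGroup W] [Module ℂ W]

/-- The cross product `n × ·` of the `G₂`-structure with adapted basis `E`: the endomorphism that
the metric associates with the two-form `n ⌟ φ`. -/
def crossEnd (E : Basis (Fin 7) ℂ W) (n : W) : End ℂ W where
  toFun x := ∑ i, phiForm E ![n, x, E i] • E i
  map_add' x y := by
    simp only [← Finset.sum_add_distrib, ← add_smul]
    refine Finset.sum_congr rfl fun i _ => congrArg (· • E i) ?_
    simp only [phiForm_apply, map_add, ← Finset.sum_add_distrib]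
    exact Finset.sum_congr rfl fun _ _ => by ring
  map_smul' c x := by
    simp only [Finset.smul_sum, smul_smul, RingHom.id_apply]
    refine Finset.sum_congr rfl fun i _ => congrArg (· • E i) ?_
    simp only [phiForm_apply, map_smul, smul_eq_mul, Finset.mul_sum]
    exact Finset.sum_congr rfl fun _ _ => by ring

theorem coord_crossEnd (E : Basis (Fin 7) ℂ W) (n x : W) (i : Fin 7) :
    E.coord i (crossEnd E n x) = phiForm E ![n, x, E i] := by
  simp [crossEnd, Finsupp.single_apply]

theorem orthoForm_crossEnd (E : Basis (Fin 7) ℂ W) (n x y : W) :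
    orthoForm E (crossEnd E n x) y = phiForm E ![n, x, y] := by
  simp only [orthoForm_apply, coord_crossEnd, Fin.sum_univ_seven]
  simp only [phiForm_apply, Fin.sum_univ_seven, lineSign, line, Matrix.cons_val, Basis.coord_apply,
    Basis.repr_self, Finsupp.single_apply, Fin.reduceEq, if_true, if_false]
  ring

theorem isAlt_orthoForm_comp_crossEnd (E : Basis (Fin 7) ℂ W) (n : W) :
    (orthoForm E ∘ₗ crossEnd E n).IsAlt := fun x => by
  rw [LinearMap.comp_apply, orthoForm_crossEnd]
  exact (phiForm E).map_eq_zero_of_eq ![n, x, x] (i := 1) (j := 2) rfl (by decide)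

theorem orthoForm_crossEnd_crossEnd (E : Basis (Fin 7) ℂ W) (n x y : W) :
    orthoForm E (crossEnd E n x) (crossEnd E n y) =
      orthoForm E n n * orthoForm E x y - orthoForm E n x * orthoForm E n y := by
  simp only [orthoForm_apply, coord_crossEnd, Fin.sum_univ_seven]
  simp only [phiForm_apply, Fin.sum_univ_seven, lineSign, line, Matrix.cons_val, Basis.coord_apply,
    Basis.repr_self, Finsupp.single_apply, Fin.reduceEq, if_true, if_false]
  ring

theorem crossEnd_crossEnd (E : Basis (Fin 7) ℂ W) (n x : W) :
    crossEnd E n (crossEnd E n x) = orthoForm E n x • n - orthoForm E n n • x := by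
  refine sub_eq_zero.1 ((orthoForm_nondegenerate E).1 _ fun y => ?_)
  have hskew := LinearMap.IsAlt.neg (isAlt_orthoForm_comp_crossEnd E n) y (crossEnd E n x)
  simp only [LinearMap.comp_apply, orthoForm_crossEnd_crossEnd, orthoForm_comm E y x] at hskew
  simp only [map_sub, map_smul, LinearMap.sub_apply, LinearMap.smul_apply, smul_eq_mul, ← hskew]
  ring

theorem orthoForm_self_crossEnd (E : Basis (Fin 7) ℂ W) (n x : W) :
    orthoForm E n (crossEnd E n x) = 0 := by
  rw [orthoForm_comm, orthoForm_crossEnd]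
  exact (phiForm E).map_eq_zero_of_eq ![n, x, n] (i := 0) (j := 2) rfl (by decide)

theorem crossEnd_swap (E : Basis (Fin 7) ℂ W) (n x : W) : crossEnd E n x = -crossEnd E x n := by
  refine E.ext_elem fun i => ?_
  have := (phiForm E).map_swap ![x, n, E i] (i := 0) (j := 1) (by decide)
  have hswap : ![x, n, E i] ∘ Equiv.swap 0 1 = ![n, x, E i] := by
    ext j
    fin_cases j <;> rfl
  rw [hswap, ← coord_crossEnd, ← coord_crossEnd] at this
  simpa using this

theorem crossEnd_self (E : Basis (Fin 7) ℂ W) (n : W) : crossEnd E n n = 0 := by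
  refine (orthoForm_nondegenerate E).1 _ fun y => ?_
  rw [orthoForm_crossEnd]
  exact (phiForm E).map_eq_zero_of_eq ![n, n, y] (i := 0) (j := 1) rfl (by decide)

theorem ker_crossEnd_of_ne_zero (E : Basis (Fin 7) ℂ W) {n : W} (h : orthoForm E n n ≠ 0) :
    LinearMap.ker (crossEnd E n) = ℂ ∙ n := by
  refine le_antisymm (fun x hx => ?_) ?_
  · have hsq := crossEnd_crossEnd E n x
    rw [LinearMap.mem_ker.1 hx, map_zero, eq_comm, sub_eq_zero] at hsq
    rw [← inv_smul_smul₀ h x, ← hsq]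
    exact Submodule.smul_mem _ _ (Submodule.smul_mem _ _ (Submodule.mem_span_singleton_self n))
  · rw [Submodule.span_singleton_le_iff_mem]
    exact crossEnd_self E n

theorem finrank_range_crossEnd_of_ne_zero (E : Basis (Fin 7) ℂ W) {n : W}
    (h : orthoForm E n n ≠ 0) : finrank ℂ (LinearMap.range (crossEnd E n)) = 6 := by
  have := E.finiteDimensional_of_finite
  have hn : n ≠ 0 := by
    rintro rfl
    simp at h
  have hrank := (crossEnd E n).finrank_range_add_finrank_ker
  rw [ker_crossEnd_of_ne_zero E h, finrank_span_singleton hn, finrank_eq_card_basis E,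
    Fintype.card_fin] at hrank
  lia

theorem orthoForm_self_eq_zero_of_mem_ker_crossEnd (E : Basis (Fin 7) ℂ W) {n : W} (hn : n ≠ 0)
    (h : orthoForm E n n = 0) {x : W} (hx : crossEnd E n x = 0) : orthoForm E x x = 0 := by
  have hnx := crossEnd_crossEnd E n x
  rw [hx, map_zero, h, zero_smul, sub_zero, eq_comm, smul_eq_zero_iff_left hn] at hnx
  have hxn := crossEnd_crossEnd E x n
  rw [crossEnd_swap E x n, hx, neg_zero, map_zero, orthoForm_comm, hnx, zero_smul, zero_sub] at hxn
  exact (smul_eq_zero_iff_left hn).1 (neg_eq_zero.1 hxn.symm)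

theorem ker_crossEnd_le_orthogonal (E : Basis (Fin 7) ℂ W) {n : W} (hn : n ≠ 0)
    (h : orthoForm E n n = 0) :
    LinearMap.ker (crossEnd E n) ≤
      LinearMap.BilinForm.orthogonal (orthoForm E) (LinearMap.ker (crossEnd E n)) := by
  have hnull {z : W} (hz : z ∈ LinearMap.ker (crossEnd E n)) : orthoForm E z z = 0 :=
    orthoForm_self_eq_zero_of_mem_ker_crossEnd E hn h hz
  intro y hy x hx
  have hsum := hnull (add_mem hx hy)
  simp only [map_add, LinearMap.add_apply, hnull hx, hnull hy, orthoForm_comm E y x] at hsum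
  change orthoForm E x y = 0
  linear_combination (1 / 2) * hsum

theorem finrank_ker_crossEnd_le (E : Basis (Fin 7) ℂ W) {n : W} (hn : n ≠ 0)
    (h : orthoForm E n n = 0) : finrank ℂ (LinearMap.ker (crossEnd E n)) ≤ 3 := by
  have := E.finiteDimensional_of_finite
  have hle := Submodule.finrank_mono (ker_crossEnd_le_orthogonal E hn h)
  rw [LinearMap.BilinForm.finrank_orthogonal (orthoForm_nondegenerate E),
    finrank_eq_card_basis E, Fintype.card_fin] at hle
  lia

theorem finrank_range_crossEnd_le (E : Basis (Fin 7) ℂ W) {n : W} (h : orthoForm E n n = 0) :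
    finrank ℂ (LinearMap.range (crossEnd E n)) ≤ finrank ℂ (LinearMap.ker (crossEnd E n)) + 1 := by
  have := E.finiteDimensional_of_finite
  set N := crossEnd E n
  let R := N.domRestrict (LinearMap.range N)
  have hrange : finrank ℂ (LinearMap.range R) ≤ 1 := by
    refine (Submodule.finrank_mono ?_).trans ((finrank_span_le_card {n}).trans (by simp))
    rintro _ ⟨⟨_, x, rfl⟩, rfl⟩
    change N (N x) ∈ _
    rw [crossEnd_crossEnd, h, zero_smul, sub_zero]
    exact Submodule.smul_mem _ _ (Submodule.mem_span_singleton_self n)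
  have hker : finrank ℂ (LinearMap.ker R) ≤ finrank ℂ (LinearMap.ker N) :=
    LinearMap.finrank_le_finrank_of_injective
      (f := (LinearMap.range N).subtype.restrict (p := LinearMap.ker R) fun _ hx => hx)
      fun _ _ hxy => Subtype.ext (Subtype.ext (congrArg (fun z : LinearMap.ker N => (z : W)) hxy))
  have := R.finrank_range_add_finrank_ker
  lia

theorem finrank_range_crossEnd_of_null (E : Basis (Fin 7) ℂ W) {n : W} (hn : n ≠ 0)
    (h : orthoForm E n n = 0) : finrank ℂ (LinearMap.range (crossEnd E n)) = 4 := by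
  have := E.finiteDimensional_of_finite
  have hker := finrank_ker_crossEnd_le E hn h
  have hrange := finrank_range_crossEnd_le E h
  have hrank := (crossEnd E n).finrank_range_add_finrank_ker
  rw [finrank_eq_card_basis E, Fintype.card_fin] at hrank
  lia

end CrossProduct

section Criterion

theorem exists_orderEmb_fin_zero {k l n : ℕ} (hn : n + 1 = k + 1 + l) {w : Fin l → Fin (n + 1)}
    (hw : Function.Injective w) (hw₀ : ∀ i, w i ≠ 0) :
    ∃ L : Fin (k + 1) ↪o Fin (n + 1), L 0 = 0 ∧ ∀ i j, L i ≠ w j := by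
  let s : Finset (Fin (n + 1)) := (Finset.univ.image w)ᶜ
  have hs : s.card = k + 1 := by
    rw [Finset.card_compl, Finset.card_image_of_injective _ hw, Finset.card_fin, Fintype.card_fin]
    lia
  have hzero : 0 ∈ s := by simpa [s] using hw₀
  refine ⟨s.orderEmbOfFin hs, ?_, fun i j hij => ?_⟩
  · exact (Finset.orderEmbOfFin_zero hs k.succ_pos).trans
      (le_antisymm (s.min'_le 0 hzero) (Fin.zero_le _))
  · have := s.orderEmbOfFin_mem hs i
    simp [s, hij] at this

variable {W : Type*} [AddCommGroup W] [Module ℂ W] [FiniteDimensional ℂ W]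

theorem exists_basis_coord_zero_eq {α : Dual ℂ W} {e : W} (he : α e = 1) :
    ∃ E : Basis (Fin (finrank ℂ (LinearMap.ker α) + 1)) ℂ W, E 0 = e ∧ E.coord 0 = α := by
  have notMem (c : ℂ) (x : W) (hx : x ∈ LinearMap.ker α) (h : c • e + x = 0) : c = 0 := by
    simpa [he, LinearMap.mem_ker.1 hx] using congrArg α h
  let E := Basis.mkFinCons e (finBasis ℂ (LinearMap.ker α)) notMem fun z =>
    ⟨-α z, by simp [he]⟩
  have hE : E 0 = e := by simp [E]
  refine ⟨E, hE, E.ext fun i => ?_⟩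
  rw [Basis.coord_apply, E.repr_self, Finsupp.single_apply]
  cases i using Fin.cases with
  | zero => rw [hE, he, if_pos rfl]
  | succ i => simp [E]

theorem forall_wedge_covectorWedge_eq_zero_iff {k l : ℕ} (hW : finrank ℂ W = k + 1 + l)
    {α : Dual ℂ W} {e : W} (he : α e = 1) {χ : Form W l} :
    (∀ δ : Fin (k + 1) → Dual ℂ W, δ 0 = α → wedge (covectorWedge δ) χ = 0) ↔
      ∀ v : Fin l → W, (∀ j, α (v j) = 0) → χ v = 0 := by
  refine ⟨fun h v hv => ?_, fun h δ hδ => ?_⟩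
  · obtain ⟨E, rfl, hα⟩ := exists_basis_coord_zero_eq he
    have comp_eq_zero : χ.compLinearMap (LinearMap.id - α.smulRight (E 0)) = 0 := by
      refine E.ext_alternating fun w hw => ?_
      by_cases hw₀ : ∀ i, w i ≠ 0
      · rw [finrank_eq_card_basis E, Fintype.card_fin] at hW
        obtain ⟨L, hL₀, hL⟩ := exists_orderEmb_fin_zero hW hw hw₀
        have hwedge := basisForm_wedge_apply_basis E L.injective hL χ
        rw [basisForm, h _ (by rw [hL₀, hα])] at hwedge
        refine Eq.trans (congrArg χ (funext fun i => ?_)) hwedge.symm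
        simp [← hα, hw₀ i]
      · push Not at hw₀
        obtain ⟨i, hi⟩ := hw₀
        exact χ.map_coord_zero i (by simp [hi, he])
    have := congrArg (· v) comp_eq_zero
    simpa [hv] using this
  · subst hδ
    exact wedge_covectorWedge_eq_zero_of_ker he h

theorem wedge_formDeriv_psiForm (E : Basis (Fin 7) ℂ W) {F G : End ℂ W}
    (hG : LinearMap.IsAdjointPair (orthoForm E) (orthoForm E) G F) (v : Fin 3 → W) :
    wedge (covectorWedge fun k => orthoForm E (v k)) (formDeriv F (psiForm E)) =
      (LinearMap.trace ℂ W F * phiForm E v - formDeriv G (phiForm E) v) • volForm E := by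
  have flat_comp (i : Fin 3) :
      Function.update (fun k => orthoForm E (v k)) i (orthoForm E (v i) ∘ₗ F) =
        fun k => orthoForm E (Function.update v i (G (v i)) k) := by
    have : orthoForm E (v i) ∘ₗ F = orthoForm E (G (v i)) := LinearMap.ext fun y => (hG _ y).symm
    rw [this]
    exact (Function.comp_update (orthoForm E) v i (G (v i))).symm
  have leibniz := formDeriv_wedge F (covectorWedge fun k => orthoForm E (v k)) (psiForm E)
  rw [formDeriv_eq_trace_smul E, formDeriv_covectorWedge, wedge_sum_left,
    covectorWedge_orthoForm_wedge_psiForm] at leibniz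
  simp only [flat_comp, covectorWedge_orthoForm_wedge_psiForm, ← Finset.sum_smul] at leibniz
  rw [sub_smul, mul_smul, leibniz, formDeriv_apply, add_sub_cancel_left]

theorem formDeriv_psiForm_eq_zero_on_ker_iff (E : Basis (Fin 7) ℂ W) {F G : End ℂ W}
    (hG : LinearMap.IsAdjointPair (orthoForm E) (orthoForm E) G F) {n e : W}
    (he : orthoForm E n e = 1) (hGn : G n = 0) :
    (∀ v : Fin 4 → W, (∀ i, orthoForm E n (v i) = 0) → formDeriv F (psiForm E) v = 0) ↔
      IsConformalEnd (orthoForm E ∘ₗ crossEnd E n) G (LinearMap.trace ℂ W F) := by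
  have hW : finrank ℂ W = 3 + 4 := by rw [finrank_eq_card_basis E, Fintype.card_fin]
  have formDeriv_phi (x y : W) : formDeriv G (phiForm E) ![n, x, y] =
      phiForm E ![n, G x, y] + phiForm E ![n, x, G y] := by
    have update_one : Function.update ![n, x, y] 1 (G x) = ![n, G x, y] := by
      ext j; fin_cases j <;> rfl
    have update_two : Function.update ![n, x, y] 2 (G y) = ![n, x, G y] := by
      ext j; fin_cases j <;> rfl
    simp [formDeriv_apply, Fin.sum_univ_three, hGn, update_one, update_two]
  rw [← forall_wedge_covectorWedge_eq_zero_iff (k := 2) hW he]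
  constructor
  · intro h x y
    have hwedge := wedge_formDeriv_psiForm E hG ![n, x, y]
    rw [h _ rfl, eq_comm, smul_eq_zero_iff_left (volForm_ne_zero E), formDeriv_phi] at hwedge
    simp only [LinearMap.comp_apply, orthoForm_crossEnd]
    exact (sub_eq_zero.1 hwedge).symm
  · intro h δ hδ
    choose v hv using fun j => (LinearMap.BilinForm.toDual _ (orthoForm_nondegenerate E)).surjective
      (δ j)
    have hn : v 0 = n := (LinearMap.BilinForm.toDual _ (orthoForm_nondegenerate E)).injective
      ((hv 0).trans hδ)
    have hvn : v = ![n, v 1, v 2] := by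
      ext j; fin_cases j <;> simp [hn]
    obtain rfl : δ = fun j => orthoForm E (v j) := funext fun j => (hv j).symm
    rw [wedge_formDeriv_psiForm E hG, hvn, formDeriv_phi, ← orthoForm_crossEnd,
      ← orthoForm_crossEnd, ← orthoForm_crossEnd]
    exact smul_eq_zero_of_left (sub_eq_zero.2 (h (v 1) (v 2)).symm) _

end Criterion

section Hyperplane

variable {K V W W₀ : Type*} [Field K] [AddCommGroup V] [Module K V] [AddCommGroup W] [Module K W]
  [AddCommGroup W₀] [Module K W₀]

theorem injective_coprod_subtype_toSpanSingleton {α : Dual K W} {e : W} (he : α e = 1) :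
    Function.Injective ((LinearMap.ker α).subtype.coprod (LinearMap.toSpanSingleton K W e)) := by
  refine (injective_iff_map_eq_zero _).2 fun ⟨k, c⟩ h => ?_
  have hc : c = 0 := by simpa [he, LinearMap.mem_ker.1 k.2] using congrArg α h
  subst hc
  exact Prod.ext (Subtype.ext (by simpa using h)) rfl

theorem exists_linearEquiv_comp_eq_of_dual [FiniteDimensional K W] [FiniteDimensional K W₀]
    (h : finrank K W = finrank K W₀) {α : Dual K W} {α₀ : Dual K W₀} (hα : α ≠ 0) (hα₀ : α₀ ≠ 0)
    {i : V →ₗ[K] W} {i₀ : V →ₗ[K] W₀} (hi : Function.Injective i) (hi₀ : Function.Injective i₀)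
    (hαi : α ∘ₗ i = 0) (hαi₀ : α₀ ∘ₗ i₀ = 0) :
    ∃ T : W ≃ₗ[K] W₀, T.toLinearMap ∘ₗ i = i₀ ∧ α₀ ∘ₗ T.toLinearMap = α := by
  obtain ⟨e, he⟩ := LinearMap.surjective hα 1
  obtain ⟨e₀, he₀⟩ := LinearMap.surjective hα₀ 1
  have hker : finrank K (LinearMap.ker α) = finrank K (LinearMap.ker α₀) := by
    have := Module.Dual.finrank_ker_add_one_of_ne_zero hα
    have := Module.Dual.finrank_ker_add_one_of_ne_zero hα₀
    lia
  obtain ⟨T₁, hT₁⟩ := exists_linearEquiv_comp_eq hker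
    (i := i.codRestrict (LinearMap.ker α) (LinearMap.congr_fun hαi))
    (i' := i₀.codRestrict (LinearMap.ker α₀) (LinearMap.congr_fun hαi₀))
    (fun _ _ hxy => hi (congrArg Subtype.val hxy)) fun _ _ hxy => hi₀ (congrArg Subtype.val hxy)
  obtain ⟨T, hT⟩ := exists_linearEquiv_comp_eq h (injective_coprod_subtype_toSpanSingleton he)
    (i' := (LinearMap.ker α₀).subtype.coprod (LinearMap.toSpanSingleton K W₀ e₀) ∘ₗ
      (T₁.prodCongr (LinearEquiv.refl K K)).toLinearMap)
    ((injective_coprod_subtype_toSpanSingleton he₀).comp (LinearEquiv.injective _))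
  have apply_add (k : LinearMap.ker α) (c : K) : T (k + c • e) = T₁ k + c • e₀ := by
    simpa using LinearMap.congr_fun hT (k, c)
  refine ⟨T, LinearMap.ext fun v => ?_, LinearMap.ext fun x => ?_⟩
  · have hv := congrArg Subtype.val (LinearMap.congr_fun hT₁ v)
    have := apply_add ⟨i v, LinearMap.congr_fun hαi v⟩ 0
    rw [zero_smul, add_zero, zero_smul, add_zero] at this
    exact this.trans hv
  · have hx : x - α x • e ∈ LinearMap.ker α := by simp [he]
    have := congrArg α₀ (apply_add ⟨_, hx⟩ (α x))
    rw [sub_add_cancel, map_add, LinearMap.mem_ker.1 (T₁ _).2] at this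
    simpa [he₀] using this

end Hyperplane

section TraceConformal

variable {W W₀ : Type*} [AddCommGroup W] [Module ℂ W] [AddCommGroup W₀] [Module ℂ W₀]

theorem orthoForm_isSymm (E : Basis (Fin 7) ℂ W) : (orthoForm E).IsSymm :=
  ⟨orthoForm_comm E⟩

theorem orthoForm_map (E : Basis (Fin 7) ℂ W₀) (T : W₀ ≃ₗ[ℂ] W) (x y : W) :
    orthoForm (E.map T) x y = orthoForm E (T.symm x) (T.symm y) := by
  simp [orthoForm_apply]

theorem crossEnd_map (E : Basis (Fin 7) ℂ W₀) (T : W₀ ≃ₗ[ℂ] W) (n x : W) :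
    crossEnd (E.map T) n x = T (crossEnd E (T.symm n) (T.symm x)) := by
  refine (E.map T).ext_elem fun i => ?_
  have hcoord := coord_crossEnd E (T.symm n) (T.symm x) i
  rw [Basis.coord_apply, phiForm_apply] at hcoord
  rw [← Basis.coord_apply, coord_crossEnd, phiForm_apply]
  simp [hcoord]

theorem exists_finrank_range_crossEnd_eq {d : ℕ} (hd : d = 6 ∨ d = 4) :
    ∃ n : Fin 7 → ℂ, n ≠ 0 ∧ finrank ℂ (LinearMap.range (crossEnd (Pi.basisFun ℂ _) n)) = d := by
  rcases hd with rfl | rfl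
  · refine ⟨Pi.single 6 1, by simp, finrank_range_crossEnd_of_ne_zero _ ?_⟩
    simp [orthoForm_apply, Fin.sum_univ_seven]
  · have hn : (Pi.single 5 1 + Pi.single 6 Complex.I : Fin 7 → ℂ) ≠ 0 := fun h => by
      simpa using congrFun h 5
    refine ⟨_, hn, finrank_range_crossEnd_of_null _ hn ?_⟩
    simp [orthoForm_apply, Fin.sum_univ_seven]

theorem formDeriv_psiForm_eq_zero_on_ker_iff_exists [FiniteDimensional ℂ W]
    (E : Basis (Fin 7) ℂ W) {F : End ℂ W} {n : W} (hn : n ≠ 0)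
    (hF : orthoForm E n ∘ₗ F = 0) {V : Type*} [AddCommGroup V] [Module ℂ V]
    {σ : LinearMap.BilinForm ℂ V} (hσ : σ.IsAlt) {p : W →ₗ[ℂ] V} (hp : Function.Surjective p)
    {j : V →ₗ[ℂ] W} (hj : ∀ s x, orthoForm E (j s) x = σ s (p x))
    (hjp : j ∘ₗ p = crossEnd E n) :
    (∀ v : Fin 4 → W, (∀ i, orthoForm E n (v i) = 0) → formDeriv F (psiForm E) v = 0) ↔
      ∃ f : End ℂ V, F ∘ₗ j = j ∘ₗ f ∧ IsConformalEnd σ f (LinearMap.trace ℂ W F) := by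
  have nondeg := orthoForm_nondegenerate E
  let G := LinearMap.BilinForm.leftAdjointOfNondegenerate (orthoForm E) nondeg F
  have hG : LinearMap.IsAdjointPair (orthoForm E) (orthoForm E) G F :=
    LinearMap.BilinForm.isAdjointPairLeftAdjointOfNondegenerate _ nondeg F
  have hGn : G n = 0 := nondeg.1 _ fun y => (hG n y).trans (LinearMap.congr_fun hF y)
  obtain ⟨e, he⟩ := LinearMap.surjective
    (fun h => hn (nondeg.1 n (LinearMap.congr_fun h)) : orthoForm E n ≠ 0) 1
  have hω : orthoForm E ∘ₗ crossEnd E n = σ.compl₁₂ p p := by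
    ext x y
    rw [← hjp]
    exact hj (p x) y
  rw [formDeriv_psiForm_eq_zero_on_ker_iff E hG he hGn, hω,
    isConformalEnd_compl₁₂_iff nondeg (orthoForm_isSymm E) hσ hp hj hG]

variable {F : End ℂ W} {U : Submodule ℂ W} {f : End ℂ U} {α : Dual ℂ W}

theorem trace_eq_of_range_le [FiniteDimensional ℂ W] (hFU : ∀ x, F x ∈ U)
    (hFf : F ∘ₗ U.subtype = U.subtype ∘ₗ f) : LinearMap.trace ℂ W F = LinearMap.trace ℂ U f := by
  have hf : F.codRestrict U hFU ∘ₗ U.subtype = f :=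
    LinearMap.ext fun u => Subtype.ext (LinearMap.congr_fun hFf u)
  rw [← hf]
  exact (LinearMap.trace_comp_comm' U.subtype (F.codRestrict U hFU)).symm

theorem hasTraceConformalSubspace_of_formDeriv_psiForm [FiniteDimensional ℂ W]
    {E : Basis (Fin 7) ℂ W} {n : W} (hn : n ≠ 0)
    (hU : ∀ x, x ∈ U ↔ orthoForm E n x = 0) (hFU : ∀ x, F x ∈ U)
    (hFf : F ∘ₗ U.subtype = U.subtype ∘ₗ f)
    (h : ∀ v : Fin 4 → W, (∀ i, orthoForm E n (v i) = 0) → formDeriv F (psiForm E) v = 0) :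
    HasTraceConformalSubspace f (finrank ℂ (LinearMap.range (crossEnd E n))) := by
  have range_le : LinearMap.range (crossEnd E n) ≤ U := by
    rintro _ ⟨x, rfl⟩
    rw [hU, orthoForm_self_crossEnd]
  obtain ⟨σ, hσ, hσn, hσE⟩ :=
    exists_bilinForm_range_of_isAlt (orthoForm_nondegenerate E) (isAlt_orthoForm_comp_crossEnd E n)
  obtain ⟨g, hFg, hg⟩ := (formDeriv_psiForm_eq_zero_on_ker_iff_exists E hn
    (LinearMap.ext fun x => (hU _).1 (hFU x)) hσ (LinearMap.surjective_rangeRestrict _)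
    (j := (LinearMap.range (crossEnd E n)).subtype) hσE rfl).1 h
  rw [trace_eq_of_range_le hFU hFf] at hg
  refine .of_injective (Submodule.inclusion_injective range_le) hσ hσn ?_ hg
  ext s
  exact (LinearMap.congr_fun hFf (Submodule.inclusion range_le s)).symm.trans
    (LinearMap.congr_fun hFg s)

theorem exists_crossEnd_eq_comp [FiniteDimensional ℂ W] (hW : finrank ℂ W = 7) (hα : α ≠ 0)
    {V : Type*} [AddCommGroup V] [Module ℂ V] [FiniteDimensional ℂ V]
    {σ : LinearMap.BilinForm ℂ V} (hσ : σ.IsAlt) (hσn : σ.Nondegenerate)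
    {i : V →ₗ[ℂ] W} (hi : Function.Injective i) (hαi : α ∘ₗ i = 0)
    (E₀ : Basis (Fin 7) ℂ W₀) {n₀ : W₀} (hn₀ : n₀ ≠ 0)
    (hV : finrank ℂ V = finrank ℂ (LinearMap.range (crossEnd E₀ n₀))) :
    ∃ (E : Basis (Fin 7) ℂ W) (n : W) (p : W →ₗ[ℂ] V), orthoForm E n = α ∧
      Function.Surjective p ∧ (∀ s x, orthoForm E (i s) x = σ s (p x)) ∧ i ∘ₗ p = crossEnd E n := by
  have := E₀.finiteDimensional_of_finite
  have nondeg := orthoForm_nondegenerate E₀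
  obtain ⟨σ₀, hσ₀, hσ₀n, hσ₀E⟩ :=
    exists_bilinForm_range_of_isAlt nondeg (isAlt_orthoForm_comp_crossEnd E₀ n₀)
  obtain ⟨t, ht⟩ := exists_symplectic_equiv hσ hσ₀ hσn hσ₀n hV
  have hα₀ : orthoForm E₀ n₀ ≠ 0 := fun h => hn₀ (nondeg.1 n₀ (LinearMap.congr_fun h))
  have hα₀t : orthoForm E₀ n₀ ∘ₗ (Submodule.subtype _ ∘ₗ t.toLinearMap) = 0 := by
    ext v
    obtain ⟨x, hx⟩ := (t v).2
    simp [← hx, orthoForm_self_crossEnd]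
  obtain ⟨T, hT, hαT⟩ := exists_linearEquiv_comp_eq_of_dual
    (hW.trans (by rw [finrank_eq_card_basis E₀, Fintype.card_fin])) hα hα₀ hi
    ((Submodule.subtype_injective _).comp t.injective) hαi hα₀t
  replace hT (v : V) : T (i v) = t v := LinearMap.congr_fun hT v
  refine ⟨E₀.map T.symm, T.symm n₀,
    t.symm.toLinearMap ∘ₗ (crossEnd E₀ n₀).rangeRestrict ∘ₗ T.toLinearMap, ?_, ?_, ?_, ?_⟩
  · ext x
    rw [orthoForm_map, ← hαT, LinearEquiv.symm_symm, T.apply_symm_apply]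
    rfl
  · exact t.symm.surjective.comp ((LinearMap.surjective_rangeRestrict _).comp T.surjective)
  · intro v x
    rw [orthoForm_map, ← ht, LinearEquiv.symm_symm, hT, hσ₀E]
    exact congrArg (σ₀ (t v)) (t.apply_symm_apply _).symm
  · ext x
    apply T.injective
    simp [crossEnd_map, hT]

theorem HasTraceConformalSubspace.exists_basis [FiniteDimensional ℂ W]
    (hW : finrank ℂ W = 7) (hα : α ≠ 0) (hU : ∀ x, x ∈ U ↔ α x = 0) (hFU : ∀ x, F x ∈ U)
    (hFf : F ∘ₗ U.subtype = U.subtype ∘ₗ f) {d : ℕ} (hd : d = 6 ∨ d = 4)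
    (h : HasTraceConformalSubspace f d) :
    ∃ (E : Basis (Fin 7) ℂ W) (n : W), orthoForm E n = α ∧
      finrank ℂ (LinearMap.range (crossEnd E n)) = d ∧
      ∀ v : Fin 4 → W, (∀ i, α (v i) = 0) → formDeriv F (psiForm E) v = 0 := by
  obtain ⟨S, σ, g, rfl, hσ, hσn, hfg, hg⟩ := h
  obtain ⟨n₀, hn₀, hd₀⟩ := exists_finrank_range_crossEnd_eq hd
  have hi : Function.Injective (U.subtype ∘ₗ S.subtype) :=
    U.subtype_injective.comp S.subtype_injective
  obtain ⟨E, n, p, rfl, hp, hσE, hpE⟩ := exists_crossEnd_eq_comp hW hα hσ hσn hi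
    (LinearMap.ext fun s => (hU _).1 s.1.2) _ hn₀ hd₀.symm
  have hn : n ≠ 0 := fun h => hα (by rw [h, map_zero])
  refine ⟨E, n, rfl, ?_, (formDeriv_psiForm_eq_zero_on_ker_iff_exists E hn
    (LinearMap.ext fun x => (hU _).1 (hFU x)) hσ hp hσE hpE).2 ⟨g, ?_, ?_⟩⟩
  · rw [← hpE, LinearMap.range_comp_of_range_eq_top _ (LinearMap.range_eq_top.2 hp),
      LinearMap.finrank_range_of_inj hi]
  · rw [← LinearMap.comp_assoc, hFf, LinearMap.comp_assoc, hfg, LinearMap.comp_assoc]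
  · rwa [trace_eq_of_range_le hFU hFf]

end TraceConformal

section AlmostAbelian

variable {𝔤 : Type*} [LieRing 𝔤] [LieAlgebra ℂ 𝔤] {𝔲 : LieIdeal ℂ 𝔤} {e₇ : 𝔤}

theorem exists_dual_ker_eq_of_notMem {W : Type*} [AddCommGroup W] [Module ℂ W]
    [FiniteDimensional ℂ W] {U : Submodule ℂ W} (hU : finrank ℂ U + 1 = finrank ℂ W) {e : W}
    (he : e ∉ U) : ∃ α : Dual ℂ W, α e = 1 ∧ ∀ x, x ∈ U ↔ α x = 0 := by
  obtain ⟨f, hf, hle⟩ := Submodule.exists_le_ker_of_notMem he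
  have hf₀ : f ≠ 0 := by
    rintro rfl
    exact hf rfl
  have hker : U = LinearMap.ker f := Submodule.eq_of_le_of_finrank_eq hle <| by
    have := Module.Dual.finrank_ker_add_one_of_ne_zero hf₀
    lia
  exact ⟨(f e)⁻¹ • f, by simp [hf], fun x => by simp [hker, hf]⟩

theorem lie_eq_of_isLieAbelian [IsLieAbelian 𝔲] {α : Dual ℂ 𝔤} (he : α e₇ = 1)
    (hα : ∀ x, x ∈ 𝔲.toSubmodule ↔ α x = 0) (x y : 𝔤) :
    ⁅x, y⁆ = α x • LieAlgebra.ad ℂ 𝔤 e₇ y - α y • LieAlgebra.ad ℂ 𝔤 e₇ x := by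
  have sub_mem (z : 𝔤) : z - α z • e₇ ∈ 𝔲 := (hα _).2 (by simp [he])
  have lie_sub_sub : ⁅x - α x • e₇, y - α y • e₇⁆ = 0 :=
    congrArg Subtype.val (trivial_lie_zero 𝔲 𝔲 ⟨_, sub_mem x⟩ ⟨_, sub_mem y⟩)
  simp only [sub_lie, lie_sub, smul_lie, lie_smul, lie_self, smul_zero, sub_zero] at lie_sub_sub
  rw [← lie_skew x e₇] at lie_sub_sub
  rw [LieAlgebra.ad_apply, LieAlgebra.ad_apply, ← sub_eq_zero, ← lie_sub_sub]
  module

theorem ad_mem_of_dual {α : Dual ℂ 𝔤} (he : α e₇ = 1) (hα : ∀ x, x ∈ 𝔲.toSubmodule ↔ α x = 0)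
    (x : 𝔤) : LieAlgebra.ad ℂ 𝔤 e₇ x ∈ 𝔲.toSubmodule := by
  have : ⁅e₇, x - α x • e₇⁆ ∈ 𝔲 := lie_mem_right ℂ 𝔤 𝔲 _ _ ((hα _).2 (by simp [he]))
  simpa using this

theorem exists_orthoForm_eq {W : Type*} [AddCommGroup W] [Module ℂ W] [FiniteDimensional ℂ W]
    (E : Basis (Fin 7) ℂ W) (α : Dual ℂ W) : ∃ n, orthoForm E n = α :=
  (LinearMap.BilinForm.toDual _ (orthoForm_nondegenerate E)).surjective α

theorem isNondegenerateSubspace_iff {W : Type*} [AddCommGroup W] [Module ℂ W]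
    [FiniteDimensional ℂ W] {E : Basis (Fin 7) ℂ W} {n : W} (hn : n ≠ 0) {U : Submodule ℂ W}
    (hU : ∀ x, x ∈ U ↔ orthoForm E n x = 0) :
    IsNondegenerateSubspace (phiForm E) (volForm E) U ↔ orthoForm E n n ≠ 0 := by
  constructor
  · rintro ⟨B, hB, hBU⟩ hnn
    obtain rfl := hB.eq_orthoForm
    exact hn (congrArg Subtype.val (hBU.1 ⟨n, (hU n).2 hnn⟩ fun x => (hU x).1 x.2))
  · intro hnn
    have hUn : U = (orthoForm E).orthogonal (ℂ ∙ n) := by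
      ext x
      rw [hU, LinearMap.BilinForm.mem_orthogonal_iff]
      refine ⟨fun h y hy => ?_, fun h => h n (Submodule.mem_span_singleton_self n)⟩
      obtain ⟨c, rfl⟩ := Submodule.mem_span_singleton.1 hy
      simp [h]
    refine ⟨orthoForm E, isInducedForm_orthoForm E, ?_⟩
    rw [hUn]
    exact (orthoForm E).restrict_nondegenerate_orthogonal_spanSingleton
      (orthoForm_nondegenerate E) (orthoForm_isSymm E).isRefl hnn

variable [FiniteDimensional ℂ 𝔤]

theorem exists_cocalibrated_basis_iff (h𝔤 : finrank ℂ 𝔤 = 7) [IsLieAbelian 𝔲]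
    {α : Dual ℂ 𝔤} (he : α e₇ = 1) (hα : ∀ x, x ∈ 𝔲.toSubmodule ↔ α x = 0) {d : ℕ}
    (hd : d = 6 ∨ d = 4) :
    (∃ (E : Basis (Fin 7) ℂ 𝔤) (n : 𝔤), orthoForm E n = α ∧ lieExtDeriv (psiForm E) = 0 ∧
      finrank ℂ (LinearMap.range (crossEnd E n)) = d) ↔
      HasTraceConformalSubspace (LieModule.toEnd ℂ 𝔤 𝔲 e₇) d := by
  have hα₀ : α ≠ 0 := fun h => by simp [h] at he
  have closed_iff (Ψ : Form 𝔤 4) : lieExtDeriv Ψ = 0 ↔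
      ∀ v : Fin 4 → 𝔤, (∀ i, α (v i) = 0) → formDeriv (LieAlgebra.ad ℂ 𝔤 e₇) Ψ v = 0 :=
    lieExtDeriv_eq_zero_iff (lie_eq_of_isLieAbelian he hα) he Ψ
  have hFf : LieAlgebra.ad ℂ 𝔤 e₇ ∘ₗ 𝔲.toSubmodule.subtype =
      𝔲.toSubmodule.subtype ∘ₗ (LieModule.toEnd ℂ 𝔤 𝔲 e₇ : End ℂ 𝔲) := rfl
  simp only [closed_iff]
  constructor
  · rintro ⟨E, n, rfl, hE, rfl⟩
    have hn : n ≠ 0 := fun h => hα₀ (by rw [h, map_zero])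
    exact hasTraceConformalSubspace_of_formDeriv_psiForm hn hα (ad_mem_of_dual he hα) hFf hE
  · intro h
    obtain ⟨E, n, hn, hd, hE⟩ := h.exists_basis h𝔤 hα₀ hα (ad_mem_of_dual he hα) hFf hd
    exact ⟨E, n, hn, hE, hd⟩

theorem exists_cocalibrated_nondegenerate_iff (h𝔤 : finrank ℂ 𝔤 = 7) (h𝔲 : finrank ℂ 𝔲 = 6)
    [IsLieAbelian 𝔲] (he₇ : e₇ ∉ 𝔲) :
    (∃ (φ : Form 𝔤 3) (vol : Form 𝔤 7), IsCocalibratedG2Structure φ vol ∧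
      IsNondegenerateSubspace φ vol 𝔲.toSubmodule) ↔
      HasTraceConformalSubspace (LieModule.toEnd ℂ 𝔤 𝔲 e₇) 6 := by
  obtain ⟨α, he, hα⟩ := exists_dual_ker_eq_of_notMem (U := 𝔲.toSubmodule)
    (h𝔤.symm ▸ congrArg (· + 1) h𝔲) he₇
  have ne_zero {E : Basis (Fin 7) ℂ 𝔤} {n : 𝔤} (hn : orthoForm E n = α) : n ≠ 0 := by
    rintro rfl
    simp [← hn] at he
  rw [← exists_cocalibrated_basis_iff h𝔤 he hα (.inl rfl)]
  constructor
  · rintro ⟨φ, vol, hc, hU⟩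
    obtain ⟨E, rfl, rfl, hE⟩ := (isCocalibratedG2Structure_iff φ vol).1 hc
    obtain ⟨n, hn⟩ := exists_orthoForm_eq E α
    exact ⟨E, n, hn, hE, finrank_range_crossEnd_of_ne_zero E
      ((isNondegenerateSubspace_iff (ne_zero hn) (hn ▸ hα)).1 hU)⟩
  · rintro ⟨E, n, hn, hE, hd⟩
    refine ⟨_, _, (isCocalibratedG2Structure_iff _ _).2 ⟨E, rfl, rfl, hE⟩,
      (isNondegenerateSubspace_iff (ne_zero hn) (hn ▸ hα)).2 fun hnn => ?_⟩
    have := finrank_range_crossEnd_of_null E (ne_zero hn) hnn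
    lia

theorem exists_cocalibrated_iff (h𝔤 : finrank ℂ 𝔤 = 7) (h𝔲 : finrank ℂ 𝔲 = 6)
    [IsLieAbelian 𝔲] (he₇ : e₇ ∉ 𝔲) :
    (∃ (φ : Form 𝔤 3) (vol : Form 𝔤 7), IsCocalibratedG2Structure φ vol) ↔
      HasTraceConformalSubspace (LieModule.toEnd ℂ 𝔤 𝔲 e₇) 6 ∨
        HasTraceConformalSubspace (LieModule.toEnd ℂ 𝔤 𝔲 e₇) 4 := by
  obtain ⟨α, he, hα⟩ := exists_dual_ker_eq_of_notMem (U := 𝔲.toSubmodule)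
    (h𝔤.symm ▸ congrArg (· + 1) h𝔲) he₇
  rw [← exists_cocalibrated_basis_iff h𝔤 he hα (.inl rfl),
    ← exists_cocalibrated_basis_iff h𝔤 he hα (.inr rfl)]
  constructor
  · rintro ⟨φ, vol, hc⟩
    obtain ⟨E, -, -, hE⟩ := (isCocalibratedG2Structure_iff φ vol).1 hc
    obtain ⟨n, hn⟩ := exists_orthoForm_eq E α
    have hn₀ : n ≠ 0 := by
      rintro rfl
      simp [← hn] at he
    by_cases hnn : orthoForm E n n = 0
    · exact .inr ⟨E, n, hn, hE, finrank_range_crossEnd_of_null E hn₀ hnn⟩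
    · exact .inl ⟨E, n, hn, hE, finrank_range_crossEnd_of_ne_zero E hnn⟩
  · rintro (⟨E, -, -, hE, -⟩ | ⟨E, -, -, hE, -⟩) <;>
      exact ⟨_, _, (isCocalibratedG2Structure_iff _ _).2 ⟨E, rfl, rfl, hE⟩⟩

end AlmostAbelian

end G2C

end

theorem mainTheorem6 {𝔤 : Type*} [LieRing 𝔤] [LieAlgebra ℂ 𝔤] [FiniteDimensional ℂ 𝔤]
    (h𝔤 : Module.finrank ℂ 𝔤 = 7)
    (𝔲 : LieIdeal ℂ 𝔤) (h𝔲 : Module.finrank ℂ 𝔲 = 6) (habel : IsLieAbelian 𝔲)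
    (e₇ : 𝔤) (he₇ : e₇ ∉ 𝔲)
    (ω₆ : LinearMap.BilinForm ℂ 𝔲) (hω₆ : ω₆.IsAlt) (hω₆' : ω₆.Nondegenerate)
    (V₂ V₄ : Submodule ℂ 𝔲) (hV₂ : Module.finrank ℂ V₂ = 2) (hV₄ : Module.finrank ℂ V₄ = 4)
    (hV : IsCompl V₂ V₄)
    (ω₄ : LinearMap.BilinForm ℂ V₄) (hω₄ : ω₄.IsAlt) (hω₄' : ω₄.Nondegenerate) :
    ((∃ (φ : G2C.Form 𝔤 3) (vol : G2C.Form 𝔤 7),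
        G2C.IsCocalibratedG2Structure φ vol ∧
        G2C.IsNondegenerateSubspace φ vol 𝔲.toSubmodule) ↔
      G2C.IsSimilarToElementOf (LieModule.toEnd ℂ 𝔤 𝔲 e₇) (skewAdjointLieSubalgebra ω₆)) ∧
    ((∃ (φ : G2C.Form 𝔤 3) (vol : G2C.Form 𝔤 7), G2C.IsCocalibratedG2Structure φ vol) ↔
      (G2C.IsSimilarToElementOf (LieModule.toEnd ℂ 𝔤 𝔲 e₇) (skewAdjointLieSubalgebra ω₆) ∨
        G2C.IsSimilarToElementOf (LieModule.toEnd ℂ 𝔤 𝔲 e₇)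
          (G2C.lengthTwoStabilizer V₂ V₄ ω₄))) := by
  have six_iff := G2C.hasTraceConformalSubspace_six_iff
    (f := LieModule.toEnd ℂ 𝔤 𝔲 e₇) h𝔲 hω₆ hω₆'
  have four_iff := G2C.hasTraceConformalSubspace_four_iff
    (f := LieModule.toEnd ℂ 𝔤 𝔲 e₇) hV hV₄ hω₄ hω₄'
  rw [← six_iff, ← four_iff]
  exact ⟨G2C.exists_cocalibrated_nondegenerate_iff h𝔤 h𝔲 he₇,
    G2C.exists_cocalibrated_iff h𝔤 h𝔲 he₇⟩
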